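/- Let $K, P > 0$ be real numbers and put $$h(\varkappa,p)=\exp\left(-\left(\frac{\varkappa}{K}\right)^2-\left(\frac{p}{P}\right)^2\right)\qquad(\varkappa\in\mathbb{R},\ p\in\mathbb{Z}).$$ For $\nu\in\mathbb{C}$, $p\in\mathbb{Z}$ and $z\in\mathbb{C}\smallsetminus\{0\}$ let $$J_{\nu,p}(z)=J_{\nu+p}(z)\,J_{\nu-p}(\bar z),\qquad \boldsymbol{J}_{\nu,p}(z)=\frac{2\pi^2}{\sin(\pi\nu)}\bigl(J_{-\nu,-p}(z)-J_{\nu,p}(z)\bigr),$$ where $J_\nu(z)=\sum_{n\ge 0}\frac{(-1)^n(z/2)^{\nu+2n}}{n!\,\Gamma(\nu+n+1)}$ is the Bessel function of the first kind, $\arg\bar z=-\arg z$ is used in the product (which then does not depend on the choice of $\arg z$), and $\boldsymbol{J}_{\nu,p}$ is defined by its limit when $\nu\in\mathbb{Z}$. Define the Bessel integral $$H(z)=\sum_{p\in\mathbb{Z}}\int_{-\infty}^{\infty}h(\varkappa,p)\,\boldsymbol{J}_{i\varkappa,p}(z)\,(\varkappa^2+p^2)\,d\varkappa .$$ Let $$\mathrm{trh}(r,\omega)=\cosh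 r\cos\omega+i\sinh r\sin\omega,\quad k(r)=\sqrt{\pi}\,K e^{-(Kr)^2},\quad \theta(\omega)=\sqrt{\pi}\,P\sum_{q\in\mathbb{Z}}e^{-(P(\omega+\pi q))^2}.$$ Then for every $z\in\mathbb{C}\smallsetminus\{0\}$ one has $$H(z)=|2z|^2\int_{\mathbb{R}/\pi\mathbb{Z}}\int_{-\infty}^{\infty}\cos\bigl(2\,\mathrm{Re}(z\,\mathrm{trh}(r,\omega))\bigr)\,\bigl(\sinh^2 r+\sin^2\omega\bigr)\,k(r)\,\theta(\omega)\,dr\,d\omega ,$$ where $dr\,d\omega$ is Lebesgue measure on $\mathbb{R}\times\mathbb{R}/\pi\mathbb{Z}$ (so that $\mathbb{R}/\pi\mathbb{Z}$ has total mass $\pi$), and both the integral defining $H(z)$, as an integral over $\mathbb{R}\times\mathbb{Z}$, and the integral on the right converge absolutely. -/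

import Mathlib

open MeasureTheory

noncomputable section

namespace BesselIntegral

/-- The circle `ℝ/πℤ` gets its Lebesgue measure (of total mass `π`) from this. -/
instance factPiPos : Fact (0 < Real.pi) := ⟨Real.pi_pos⟩

/-- The Bessel function `J_ν` on the Riemann surface of the logarithm: its value at the
point `exp w`, where `w` is the chosen logarithm, that is the sum over `n ≥ 0` of
`(-1)^n (z/2)^(ν + 2n) / (n! Γ(ν + n + 1))` with `z = exp w`. -/
def besselJLog (ν w : ℂ) : ℂ :=
  ∑' n : ℕ, (-1 : ℂ) ^ n * Complex.exp ((ν + 2 * n) * (w - Real.log 2)) /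
    ((n.factorial : ℂ) * Complex.Gamma (ν + n + 1))

/-- `J_{ν,p}(z) = J_{ν+p}(z) J_{ν-p}(z̄)` for `z ≠ 0`, where the logarithm chosen for `z̄` is
the conjugate of the one chosen for `z`; the product does not depend on the choice of the
latter, see `besselJProd_eq`. -/
def besselJProd (ν : ℂ) (p : ℤ) (z : ℂ) : ℂ :=
  besselJLog (ν + p) (Complex.log z) *
    besselJLog (ν - p) ((starRingEnd ℂ) (Complex.log z))

/-- The quotient `(2π² / sin(πν)) (J_{-ν,-p}(z) - J_{ν,p}(z))`, meaningful for `sin(πν) ≠ 0`. -/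
def besselQuot (ν : ℂ) (p : ℤ) (z : ℂ) : ℂ :=
  2 * (Real.pi : ℂ) ^ 2 / Complex.sin (Real.pi * ν) *
    (besselJProd (-ν) (-p) z - besselJProd ν p z)

open Classical in
/-- The complex Bessel function `𝑱_{ν,p}(z)`: the above quotient, extended by its limit to the
integers `ν`, where the singularity is removable. -/
def besselBold (ν : ℂ) (p : ℤ) (z : ℂ) : ℂ :=
  if Complex.sin (Real.pi * ν) = 0 then
    Filter.limUnder (nhdsWithin ν {ν}ᶜ) (fun ν' => besselQuot ν' p z)
  else besselQuot ν p z

/-- The Lebesgue measure on `ℝ × ℤ`: Lebesgue measure times counting measure. -/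
def muA : Measure (ℝ × ℤ) := (volume : Measure ℝ).prod (Measure.count : Measure ℤ)

/-- The integrand of the Bessel integral, at `a = (κ, p)`. -/
def besselIntegrand (h : ℝ × ℤ → ℝ) (z : ℂ) (a : ℝ × ℤ) : ℂ :=
  (h a : ℂ) * besselBold (Complex.I * a.1) a.2 z * ((a.1 : ℂ) ^ 2 + (a.2 : ℂ) ^ 2)

/-- The Bessel integral `H(z)` attached to the weight `h`. -/
def besselH (h : ℝ × ℤ → ℝ) (z : ℂ) : ℂ := ∫ a, besselIntegrand h z a ∂muA

/-- The weight `h(κ, p) = exp(-(κ/K)² - (p/P)²)`. -/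
def weight (K P : ℝ) (a : ℝ × ℤ) : ℝ := Real.exp (-(a.1 / K) ^ 2 - ((a.2 : ℝ) / P) ^ 2)

/-- `trh(r, ω) = cosh r cos ω + i sinh r sin ω`. -/
def trh (r ω : ℝ) : ℂ :=
  (Real.cosh r * Real.cos ω : ℝ) + Complex.I * (Real.sinh r * Real.sin ω : ℝ)

/-- `k(r) = √π K exp(-(K r)²)`. -/
def kFun (K r : ℝ) : ℝ := Real.sqrt Real.pi * K * Real.exp (-(K * r) ^ 2)

/-- `θ(ω)` is `√π P` times the sum over all integers `q` of `exp(-(P (ω + π q))²)`. -/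
def thetaFun (P ω : ℝ) : ℝ :=
  Real.sqrt Real.pi * P * ∑' q : ℤ, Real.exp (-(P * (ω + Real.pi * q)) ^ 2)

theorem cos_trh_periodic (z : ℂ) (r : ℝ) :
    Function.Periodic (fun ω : ℝ => Real.cos (2 * (z * trh r ω).re)) Real.pi := by
  intro ω
  have h : trh r (ω + Real.pi) = -trh r ω := by
    simp only [trh, Real.cos_add_pi, Real.sin_add_pi]
    push_cast
    ring
  simp only [h, mul_neg, Complex.neg_re, Real.cos_neg]

theorem sin_sq_periodic : Function.Periodic (fun ω : ℝ => Real.sin ω ^ 2) Real.pi := by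
  intro ω
  simp only [Real.sin_add_pi, neg_sq]

theorem thetaFun_periodic (P : ℝ) : Function.Periodic (thetaFun P) Real.pi := by
  intro ω
  unfold thetaFun
  congr 1
  rw [← (Equiv.addRight (1 : ℤ)).tsum_eq
    (fun q : ℤ => Real.exp (-(P * (ω + Real.pi * q)) ^ 2))]
  refine tsum_congr fun q => ?_
  simp only [Equiv.coe_addRight]
  push_cast
  ring_nf

/-- `cos(2 Re(z trh(r, ω)))` as a function of `ω` in `ℝ/πℤ`. -/
def cosTrh (z : ℂ) (r : ℝ) (ω : AddCircle Real.pi) : ℝ :=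
  Function.Periodic.lift (cos_trh_periodic z r) ω

/-- `sin² ω` as a function of `ω` in `ℝ/πℤ`. -/
def sinSq (ω : AddCircle Real.pi) : ℝ := Function.Periodic.lift sin_sq_periodic ω

/-- `θ(ω)` as a function of `ω` in `ℝ/πℤ`. -/
def theta (P : ℝ) (ω : AddCircle Real.pi) : ℝ := Function.Periodic.lift (thetaFun_periodic P) ω

/-- A change of the logarithm multiplies `J_ν` by a constant. -/
theorem besselJLog_add (ν w : ℂ) (m : ℤ) :
    besselJLog ν (w + m * (2 * Real.pi * Complex.I)) =
      Complex.exp (ν * (m * (2 * Real.pi * Complex.I))) * besselJLog ν w := by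
  unfold besselJLog
  rw [← tsum_mul_left]
  refine tsum_congr fun n => ?_
  have h : Complex.exp ((ν + 2 * n) * (w + m * (2 * Real.pi * Complex.I) - Real.log 2)) =
      Complex.exp (ν * (m * (2 * Real.pi * Complex.I))) *
        Complex.exp ((ν + 2 * n) * (w - Real.log 2)) := by
    rw [← Complex.exp_add, Complex.exp_eq_exp_iff_exists_int]
    exact ⟨2 * n * m, by push_cast; ring⟩
  rw [h]
  ring

/-- `J_{ν,p}(z)` is well defined: it may be computed with any logarithm `w` of `z`. -/
theorem besselJProd_eq (ν : ℂ) (p : ℤ) {z w : ℂ} (hw : Complex.exp w = z) :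
    besselJProd ν p z =
      besselJLog (ν + p) w * besselJLog (ν - p) ((starRingEnd ℂ) w) := by
  have hz : z ≠ 0 := hw ▸ Complex.exp_ne_zero w
  obtain ⟨m, hm⟩ := Complex.exp_eq_exp_iff_exists_int.1 (hw.trans (Complex.exp_log hz).symm)
  have hc : (starRingEnd ℂ) w =
      (starRingEnd ℂ) (Complex.log z) + ((-m : ℤ) : ℂ) * (2 * Real.pi * Complex.I) := by
    rw [hm]
    simp [map_ofNat]
  have h1 : Complex.exp ((ν + p) * (m * (2 * Real.pi * Complex.I))) *
      Complex.exp ((ν - p) * (((-m : ℤ) : ℂ) * (2 * Real.pi * Complex.I))) = 1 := by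
    rw [← Complex.exp_add, Complex.exp_eq_one_iff]
    exact ⟨2 * p * m, by push_cast; ring⟩
  rw [hc, besselJLog_add]
  nth_rewrite 1 [hm]
  rw [besselJLog_add, besselJProd]
  linear_combination (-(besselJLog (ν + p) (Complex.log z) *
    besselJLog (ν - p) ((starRingEnd ℂ) (Complex.log z)))) * h1

end BesselIntegral

end

noncomputable section

namespace BesselIntegral

open Filter Topology Complex Set

/-! For fixed `p` the function Ψ_p(s) = (p² - s²) J_{s,p}(z) is entire in `s`. At s = iκ the factor
p² - s² becomes κ² + p² and exp((s/K)²) becomes exp(-(κ/K)²). So the κ-integral is 2π² times the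
integral of (Ψ_{-p}(-s) - Ψ_p(s)) exp((s/K)²) / sin(πs) along the imaginary axis, where the
numerator vanishes at s = 0.

The Gaussian is a Laplace transform, π exp((s/K)²) = ∫ k(r) e^{2rs} dr. For fixed `r` the residues
of Ψ_p(s) e^{2rs} / sin(πs) at the integers give the terms of the series ∑ (-1)^n Ψ_p(n) e^{2rn}.
Since Ψ_p(-n) = Ψ_{-p}(n) at integers, its two halves are two one-sided series closed to the right,
and integrating against `k` produces exactly the integral above (`integral_kFun_mul_two_sided`).

The series is a Fourier coefficient (`hasSum_besselPsi`). Applying t d/dt to exp((z/2)(t - 1/t)) = ∑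
J_m(z) t^m at t = i e^{r+iω}, doing the same for the conjugate of `z` at i e^{r-iω}, and
multiplying, gives -|z|² (sinh² r + sin² ω) exp(2i Re(z trh(r, ω))) as a double series. The
coefficient of e^{2ipω} selects orders n + p and n - p, whose product n² - p² yields Ψ_p(n).

Finally, Poisson summation writes θ(ω) as ∑ exp(-(p/P)²) e^{-2ipω} (`thetaFun_eq_tsum`), so both
sides are the same sum over `p`. The analytic work is in the bounds: 1/Γ decays factorially far to
the right (`lineBound_besselPsi`), and crude bounds elsewhere, factorial in `p`, are absorbed by the
Gaussian weights. -/

/-! ### Lower bounds for the sine and Cauchy's theorem on a strip. -/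

theorem abs_sinh_im_le_norm_sin (w : ℂ) : |Real.sinh w.im| ≤ ‖sin w‖ := by
  have h : ‖sin w‖ ^ 2 = Real.sin w.re ^ 2 + Real.sinh w.im ^ 2 := by
    have h0 : sin w = ((Real.sin w.re * Real.cosh w.im : ℝ) : ℂ) +
        ((Real.cos w.re * Real.sinh w.im : ℝ) : ℂ) * I := by
      rw [Complex.sin_eq]; push_cast; ring
    rw [h0, Complex.sq_norm, Complex.normSq_add_mul_I]
    have h1 := Real.cosh_sq w.im
    have h2 := Real.sin_sq_add_cos_sq w.re
    linear_combination (Real.sin w.re) ^ 2 * h1 + (Real.sinh w.im) ^ 2 * h2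
  refine abs_le_of_sq_le_sq ?_ (norm_nonneg _)
  nlinarith [sq_nonneg (Real.sin w.re)]

/-- The exponential growth of the sine is only needed in this weak form, which makes a bounded
function divided by sin(πs) dominated by the integrable 1 / (1 + y²). -/
theorem one_add_sq_le_norm_sin {s : ℂ} (hs : 1 ≤ |s.im|) :
    1 + s.im ^ 2 ≤ ‖sin (Real.pi * s)‖ := by
  have h := abs_sinh_im_le_norm_sin (Real.pi * s)
  have him : ((Real.pi : ℂ) * s).im = Real.pi * s.im := by simp
  rw [him, Real.abs_sinh, abs_mul, abs_of_pos Real.pi_pos] at h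
  refine le_trans ?_ h
  rw [← sq_abs s.im]
  set t := |s.im|
  have h3 := Real.pi_gt_three
  have h1 : 3 * t ≤ Real.pi * t := by nlinarith
  have h2 : Real.sinh (3 * t) ≤ Real.sinh (Real.pi * t) := Real.sinh_le_sinh.2 h1
  refine le_trans ?_ h2
  rw [Real.sinh_eq]
  have h4 : Real.exp (-(3 * t)) ≤ 1 := Real.exp_le_one_iff.2 (by linarith)
  have h5 := Real.quadratic_le_exp_of_nonneg (x := 3 * t) (by linarith)
  nlinarith

theorem sin_pi_mul_ne_zero_of_abs_re_lt_one {s : ℂ} (hs : |s.re| < 1) (h0 : s ≠ 0) :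
    sin (Real.pi * s) ≠ 0 := by
  intro h
  obtain ⟨k, hk⟩ := Complex.sin_eq_zero_iff.1 h
  have hpi : (Real.pi : ℂ) ≠ 0 := ofReal_ne_zero.2 Real.pi_ne_zero
  have : s = k := by
    apply mul_left_cancel₀ hpi
    rw [hk]; ring
  rw [this] at hs h0
  simp only [intCast_re] at hs
  have : |k| < 1 := by exact_mod_cast hs
  have : k = 0 := by simpa using Int.abs_lt_one_iff.1 this
  simp [this] at h0

theorem continuous_vertical {f : ℂ → ℂ} {a b x : ℝ} (hx : x ∈ Icc a b)
    (hf : ∀ s : ℂ, s.re ∈ Icc a b → DifferentiableAt ℂ f s) :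
    Continuous fun y : ℝ => f (x + y * I) := by
  rw [continuous_iff_continuousAt]
  intro y
  have h1 : ContinuousAt f ((x : ℂ) + y * I) := (hf _ (by simpa using hx)).continuousAt
  exact ContinuousAt.comp (f := fun y : ℝ => (x : ℂ) + y * I) h1 (by fun_prop)

theorem integrable_const_div_one_add_sq (C : ℝ) :
    Integrable fun y : ℝ => C / (1 + y ^ 2) := by
  simpa [div_eq_mul_inv] using integrable_inv_one_add_sq.const_mul C

theorem integrable_vertical {f : ℂ → ℂ} {a b x C : ℝ} (hx : x ∈ Icc a b)
    (hf : ∀ s : ℂ, s.re ∈ Icc a b → DifferentiableAt ℂ f s)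
    (hC : ∀ s : ℂ, s.re ∈ Icc a b → ‖f s‖ ≤ C / (1 + s.im ^ 2)) :
    Integrable fun y : ℝ => f (x + y * I) := by
  refine (integrable_const_div_one_add_sq C).mono'
    (continuous_vertical hx hf).aestronglyMeasurable (ae_of_all _ fun y => ?_)
  simpa using hC (x + y * I) (by simpa using hx)

/-- Cauchy's theorem for a vertical strip. -/
theorem integral_vertical_eq {f : ℂ → ℂ} {a b C : ℝ} (hab : a ≤ b)
    (hf : ∀ s : ℂ, s.re ∈ Icc a b → DifferentiableAt ℂ f s)
    (hC : ∀ s : ℂ, s.re ∈ Icc a b → ‖f s‖ ≤ C / (1 + s.im ^ 2)) :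
    ∫ y : ℝ, f (a + y * I) = ∫ y : ℝ, f (b + y * I) := by
  have ha : Tendsto (fun T : ℝ => ∫ y in (-T)..T, f (a + y * I)) atTop
      (𝓝 (∫ y : ℝ, f (a + y * I))) :=
    intervalIntegral_tendsto_integral (integrable_vertical (left_mem_Icc.2 hab) hf hC)
      tendsto_neg_atTop_atBot tendsto_id
  have hb : Tendsto (fun T : ℝ => ∫ y in (-T)..T, f (b + y * I)) atTop
      (𝓝 (∫ y : ℝ, f (b + y * I))) :=
    intervalIntegral_tendsto_integral (integrable_vertical (right_mem_Icc.2 hab) hf hC)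
      tendsto_neg_atTop_atBot tendsto_id
  -- The horizontal sides of the rectangle of height 2T contribute O(1 / (1 + T²)).
  have hhor : ∀ T : ℝ, ‖∫ x in a..b, f (x + T * I)‖ ≤ C / (1 + T ^ 2) * |b - a| := by
    intro T
    refine intervalIntegral.norm_integral_le_of_norm_le_const fun x hx => ?_
    rw [uIoc_of_le hab] at hx
    simpa using hC (x + T * I) (by simpa using ⟨hx.1.le, hx.2⟩)
  have hlim : Tendsto (fun T : ℝ => C / (1 + T ^ 2) * |b - a|) atTop (𝓝 0) := by
    have : Tendsto (fun T : ℝ => 1 + T ^ 2) atTop atTop :=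
      tendsto_atTop_add_const_left _ _ (tendsto_pow_atTop two_ne_zero)
    simpa using (this.const_div_atTop C).mul_const |b - a|
  have h1 : Tendsto (fun T : ℝ => ∫ x in a..b, f (x + T * I)) atTop (𝓝 0) :=
    squeeze_zero_norm hhor hlim
  have h2 : Tendsto (fun T : ℝ => ∫ x in a..b, f (x + (-T : ℝ) * I)) atTop (𝓝 0) :=
    squeeze_zero_norm (fun T => by simpa using hhor (-T)) hlim
  have key : ∀ T : ℝ, (∫ y in (-T)..T, f (b + y * I)) - ∫ y in (-T)..T, f (a + y * I) =
      I * ((∫ x in a..b, f (x + (-T : ℝ) * I)) - ∫ x in a..b, f (x + T * I)) := by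
    intro T
    have h := Complex.integral_boundary_rect_eq_zero_of_differentiableOn f
      (a + (-T : ℝ) * I) (b + T * I) (fun s hs => by
        refine (hf s ?_).differentiableWithinAt
        have := hs.1
        simpa [uIcc_of_le hab] using this)
    simp only [add_re, ofReal_re, mul_re, I_re, mul_zero, ofReal_im, I_im, mul_one, sub_self,
      add_zero, add_im, mul_im, zero_add, smul_eq_mul] at h
    linear_combination (-I) * h + ((∫ y in (-T)..T, f (b + y * I)) -
      (∫ y in (-T)..T, f (a + y * I))) * Complex.I_sq
  have h3 := hb.sub ha
  have h4 := (h2.sub h1).const_mul I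
  simp only [sub_zero, mul_zero] at h4
  have h5 := tendsto_nhds_unique (h3.congr key) h4
  exact (sub_eq_zero.1 h5).symm

/-! ### Line integrals against 1 / sin(πs) and their residues. -/

/-- The integral of `f(s) / sin(πs)` along the line `Re s = x`, divided by `i`. -/
def cscIntegral (f : ℂ → ℂ) (x : ℝ) : ℂ :=
  ∫ y : ℝ, f (x + y * I) / sin (Real.pi * (x + y * I))

/-- The line integral does not change across the strip where a zero of `f` cancels that of the
sine. -/
theorem cscIntegral_eq_of_apply_zero {f : ℂ → ℂ} (hf : Differentiable ℂ f) (h0 : f 0 = 0) {B : ℝ}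
    (hB : ∀ s : ℂ, |s.re| ≤ 1 / 2 → ‖f s‖ ≤ B) {a b : ℝ} (ha : -(1 / 2) ≤ a) (hab : a ≤ b)
    (hb : b ≤ 1 / 2) : cscIntegral f a = cscIntegral f b := by
  set S : ℂ → ℂ := fun s => sin (Real.pi * s) with hS
  have hSd : Differentiable ℂ S := by fun_prop
  have hpi : (Real.pi : ℂ) ≠ 0 := ofReal_ne_zero.2 Real.pi_ne_zero
  have hSder : deriv S 0 = Real.pi := by
    have : HasDerivAt S (cos (Real.pi * 0) * (Real.pi * 1)) 0 :=
      ((hasDerivAt_id (0 : ℂ)).const_mul (Real.pi : ℂ)).csin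
    simpa using this.deriv
  have hd : ∀ g : ℂ → ℂ, Differentiable ℂ g → Differentiable ℂ (dslope g 0) := fun g hg =>
    differentiableOn_univ.1 ((differentiableOn_dslope univ_mem).2 hg.differentiableOn)
  -- The quotient of the two difference quotients at 0 extends f(s) / sin(πs) holomorphically across
  -- 0.
  set F : ℂ → ℂ := fun s => dslope f 0 s / dslope S 0 s with hF
  have hne : ∀ s : ℂ, |s.re| ≤ 1 / 2 → dslope S 0 s ≠ 0 := by
    intro s hs
    by_cases h : s = 0
    · rw [h, dslope_same, hSder]; exact hpi
    · rw [dslope_of_ne _ h, slope_def_field]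
      have := sin_pi_mul_ne_zero_of_abs_re_lt_one (lt_of_le_of_lt hs (by norm_num)) h
      simpa [hS, sub_eq_zero, h] using this
  have hFeq : ∀ s : ℂ, s ≠ 0 → F s = f s / S s := by
    intro s hs
    simp only [hF, dslope_of_ne _ hs, slope_def_field, h0]
    have : S 0 = 0 := by simp [hS]
    rw [this, sub_zero, sub_zero, sub_zero]
    field_simp
  have hFd : ∀ s : ℂ, |s.re| ≤ 1 / 2 → DifferentiableAt ℂ F s := fun s hs =>
    (hd f hf s).div (hd S hSd s) (hne s hs)
  obtain ⟨C, hC⟩ : ∃ C, ∀ s : ℂ, |s.re| ≤ 1 / 2 → |s.im| ≤ 1 → ‖F s‖ ≤ C := by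
    have hK : IsCompact (Icc (-(1 / 2) : ℝ) (1 / 2) ×ℂ Icc (-1 : ℝ) 1) :=
      isCompact_Icc.reProdIm isCompact_Icc
    obtain ⟨C, hC⟩ := hK.exists_bound_of_continuousOn (f := F) fun s hs =>
      (hFd s (abs_le.2 hs.1)).continuousAt.continuousWithinAt
    exact ⟨C, fun s hs hs' => hC s ⟨abs_le.1 hs, abs_le.1 hs'⟩⟩
  have hB0 : 0 ≤ B := (norm_nonneg _).trans (hB 0 (by simp))
  have hC0 : 0 ≤ C := (norm_nonneg _).trans (hC 0 (by simp) (by simp))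
  have hbound : ∀ s : ℂ, |s.re| ≤ 1 / 2 → ‖F s‖ ≤ (2 * C + B) / (1 + s.im ^ 2) := by
    intro s hs
    have hpos : 0 < 1 + s.im ^ 2 := by positivity
    rw [le_div_iff₀ hpos]
    rcases le_total |s.im| 1 with h | h
    · have : s.im ^ 2 ≤ 1 := by rw [← sq_abs]; nlinarith [abs_nonneg s.im]
      have h1 := hC s hs h
      nlinarith [norm_nonneg (F s)]
    · have hs0 : s ≠ 0 := by rintro rfl; norm_num at h
      have h1 := one_add_sq_le_norm_sin h
      have h2 : 0 < ‖S s‖ := hpos.trans_le h1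
      rw [hFeq s hs0, norm_div, div_mul_eq_mul_div, div_le_iff₀ h2]
      have h3 := hB s hs
      change _ ≤ ‖S s‖ at h1
      nlinarith [norm_nonneg (f s), norm_nonneg (S s), mul_nonneg hC0 h2.le]
  have hstrip : ∀ s : ℂ, s.re ∈ Icc a b → |s.re| ≤ 1 / 2 := fun s hs =>
    abs_le.2 ⟨ha.trans hs.1, hs.2.trans hb⟩
  have h := integral_vertical_eq hab (fun s hs => hFd s (hstrip s hs))
    (fun s hs => hbound s (hstrip s hs))
  have hcsc : ∀ x : ℝ, cscIntegral f x = ∫ y : ℝ, F (x + y * I) := by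
    intro x
    refine integral_congr_ae ?_
    -- A line through 0 is allowed, since the integrands differ at most at the single point y = 0.
    have : ∀ᵐ y : ℝ, y ≠ 0 := by simp [ae_iff]
    filter_upwards [this] with y hy
    rw [hFeq]
    intro h
    have := congrArg Complex.im h
    simp at this
    exact hy this
  rw [hcsc, hcsc, h]

theorem sin_pi_mul_half_add (y : ℝ) :
    sin (Real.pi * (((1 / 2 : ℝ) : ℂ) + y * I)) = (Real.cosh (Real.pi * y) : ℝ) := by
  have : (Real.pi : ℂ) * (((1 / 2 : ℝ) : ℂ) + y * I) =
      ((Real.pi * y : ℝ) : ℂ) * I + Real.pi / 2 := by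
    push_cast; ring
  rw [this, Complex.sin_add_pi_div_two, Complex.cos_mul_I, ofReal_cosh]

theorem sin_pi_mul_neg_half_add (y : ℝ) :
    sin (Real.pi * (((-(1 / 2) : ℝ) : ℂ) + y * I)) = -(Real.cosh (Real.pi * y) : ℝ) := by
  have : (Real.pi : ℂ) * (((-(1 / 2) : ℝ) : ℂ) + y * I) =
      ((Real.pi * y : ℝ) : ℂ) * I - Real.pi / 2 := by
    push_cast; ring
  rw [this, Complex.sin_sub_pi_div_two, Complex.cos_mul_I, ofReal_cosh]

theorem integrable_inv_cosh_pi : Integrable fun y : ℝ => (Real.cosh (Real.pi * y))⁻¹ := by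
  refine (integrable_const_div_one_add_sq 1).mono' ?_ (ae_of_all _ fun y => ?_)
  · exact (Continuous.inv₀ (by fun_prop)
      fun y => (Real.cosh_pos _).ne').aestronglyMeasurable
  · rw [Real.norm_of_nonneg (inv_nonneg.2 (Real.cosh_pos _).le), one_div]
    refine inv_anti₀ (by positivity) ?_
    rw [← Real.cosh_abs, Real.cosh_eq, abs_mul, abs_of_pos Real.pi_pos, ← sq_abs]
    have h1 := Real.quadratic_le_exp_of_nonneg (x := Real.pi * |y|) (by positivity)
    have h2 := Real.add_one_le_exp (-(Real.pi * |y|))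
    have h3 : (3 * |y|) ^ 2 ≤ (Real.pi * |y|) ^ 2 := by
      gcongr; exact Real.pi_gt_three.le
    nlinarith

/-- An antiderivative is (2/π) arctan(e^{πy}). This one explicit integral takes the place of the
residue theorem below. -/
theorem integral_inv_cosh_pi : ∫ y : ℝ, (Real.cosh (Real.pi * y))⁻¹ = 1 := by
  have hpi := Real.pi_pos
  have hder : ∀ y : ℝ, HasDerivAt (fun y => 2 / Real.pi * Real.arctan (Real.exp (Real.pi * y)))
      (Real.cosh (Real.pi * y))⁻¹ y := by
    intro y
    have h1 : HasDerivAt (fun y => Real.exp (Real.pi * y))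
        (Real.exp (Real.pi * y) * (Real.pi * 1)) y :=
      ((hasDerivAt_id y).const_mul Real.pi).exp
    refine ((h1.arctan).const_mul (2 / Real.pi)).congr_deriv ?_
    rw [Real.cosh_eq, Real.exp_neg]
    have := Real.exp_pos (Real.pi * y)
    field_simp
    ring
  have hbot : Tendsto (fun y => 2 / Real.pi * Real.arctan (Real.exp (Real.pi * y))) atBot
      (𝓝 (2 / Real.pi * Real.arctan 0)) :=
    ((Real.continuous_arctan.tendsto 0).comp (Real.tendsto_exp_atBot.comp
      (tendsto_id.const_mul_atBot hpi))).const_mul _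
  have htop : Tendsto (fun y => 2 / Real.pi * Real.arctan (Real.exp (Real.pi * y))) atTop
      (𝓝 (2 / Real.pi * (Real.pi / 2))) :=
    ((tendsto_nhds_of_tendsto_nhdsWithin Real.tendsto_arctan_atTop).comp
      (Real.tendsto_exp_atTop.comp (tendsto_id.const_mul_atTop hpi))).const_mul _
  rw [integral_of_hasDerivAt_of_tendsto hder integrable_inv_cosh_pi hbot htop]
  simp

theorem sin_add_int_mul_pi' (s : ℂ) (N : ℤ) : sin (s + N * Real.pi) = (-1) ^ N * sin s :=
  N.cast_negOnePow ℂ ▸ Complex.sin_antiperiodic.add_int_mul_eq N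

theorem norm_sin_pi_mul_int_add_half (N : ℤ) (y : ℝ) :
    ‖sin (Real.pi * (((N + 1 / 2 : ℝ) : ℂ) + y * I))‖ = Real.cosh (Real.pi * y) := by
  have h : (Real.pi : ℂ) * (((N + 1 / 2 : ℝ) : ℂ) + y * I) =
      Real.pi * (((1 / 2 : ℝ) : ℂ) + y * I) + N * Real.pi := by
    push_cast; ring
  rw [h, sin_add_int_mul_pi', norm_mul, norm_zpow, norm_neg, norm_one, one_zpow, one_mul,
    sin_pi_mul_half_add, norm_real, Real.norm_of_nonneg (Real.cosh_pos _).le]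

theorem norm_sin_pi_mul_nat_add_half (N : ℕ) (y : ℝ) :
    ‖sin (Real.pi * (((N + 1 / 2 : ℝ) : ℂ) + y * I))‖ = Real.cosh (Real.pi * y) := by
  simpa using norm_sin_pi_mul_int_add_half N y

theorem measurable_vertical_div_sin {f : ℂ → ℂ} (hf : Continuous f) (x : ℝ) :
    Measurable fun y : ℝ => f (x + y * I) / sin (Real.pi * (x + y * I)) :=
  (hf.comp (by fun_prop : Continuous fun y : ℝ => (x : ℂ) + y * I)).measurable.div
    (by fun_prop : Continuous fun y : ℝ => sin (Real.pi * (x + y * I))).measurable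

theorem integrable_vertical_div_sin {f : ℂ → ℂ} (hf : Continuous f) (N : ℤ) {B : ℝ}
    (hB : ∀ y : ℝ, ‖f (((N + 1 / 2 : ℝ) : ℂ) + y * I)‖ ≤ B) :
    Integrable fun y : ℝ => f (((N + 1 / 2 : ℝ) : ℂ) + y * I) /
      sin (Real.pi * (((N + 1 / 2 : ℝ) : ℂ) + y * I)) := by
  refine (integrable_inv_cosh_pi.const_mul B).mono'
    (measurable_vertical_div_sin hf _).aestronglyMeasurable (ae_of_all _ fun y => ?_)
  rw [norm_div, norm_sin_pi_mul_int_add_half, div_eq_mul_inv]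
  exact mul_le_mul_of_nonneg_right (hB y) (inv_nonneg.2 (Real.cosh_pos _).le)

theorem cscIntegral_one_half : cscIntegral (fun _ => 1) (1 / 2) = 1 := by
  simp only [cscIntegral, sin_pi_mul_half_add]
  simp only [one_div, ← ofReal_inv]
  rw [integral_complex_ofReal, integral_inv_cosh_pi, ofReal_one]

theorem cscIntegral_one_neg_half : cscIntegral (fun _ => 1) (-(1 / 2)) = -1 := by
  simp only [cscIntegral, sin_pi_mul_neg_half_add]
  simp only [one_div, inv_neg, ← ofReal_inv]
  rw [integral_neg, integral_complex_ofReal, integral_inv_cosh_pi, ofReal_one]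

theorem cscIntegral_int_add (f : ℂ → ℂ) (N : ℤ) (x : ℝ) :
    cscIntegral f (N + x) = (-1) ^ N * cscIntegral (fun s => f (s + N)) x := by
  unfold cscIntegral
  rw [← integral_const_mul]
  refine integral_congr_ae (ae_of_all _ fun y => ?_)
  have h : (Real.pi : ℂ) * (((N + x : ℝ) : ℂ) + y * I) =
      Real.pi * ((x : ℂ) + y * I) + N * Real.pi := by
    push_cast; ring
  have h2 : (((N + x : ℝ) : ℂ) + y * I) = (x : ℂ) + y * I + N := by push_cast; ring
  have h3 : ((-1 : ℂ) ^ N)⁻¹ = (-1) ^ N := by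
    rw [← inv_zpow, inv_neg, inv_one]
  simp only
  rw [h, sin_add_int_mul_pi', h2, div_eq_mul_inv, mul_inv, h3]
  ring

/-- The residue theorem for `f(s) / sin(πs)` around one integer. -/
theorem cscIntegral_sub_cscIntegral {f : ℂ → ℂ} (hf : Differentiable ℂ f) (N : ℤ) {B : ℝ}
    (hB : ∀ s : ℂ, |s.re - N| ≤ 1 / 2 → ‖f s‖ ≤ B) :
    cscIntegral f (N + 1 / 2) - cscIntegral f (N - 1 / 2) = 2 * (-1) ^ N * f N := by
  set F : ℂ → ℂ := fun s => f (s + N) with hF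
  have hFd : Differentiable ℂ F := by fun_prop
  have hFB : ∀ s : ℂ, |s.re| ≤ 1 / 2 → ‖F s‖ ≤ B := fun s hs => hB _ (by simpa using hs)
  have hB0 : 0 ≤ B := (norm_nonneg _).trans (hFB 0 (by simp))
  -- After translating the integer to 0, subtracting the constant F(0) removes the pole. The residue
  -- then comes from the constant function, whose integrals along Re s = ±1/2 are ±1.
  have hg := cscIntegral_eq_of_apply_zero (f := fun s => F s - F 0) (by fun_prop) (by simp)
    (B := B + B) (fun s hs => (norm_sub_le _ _).trans
      (add_le_add (hFB s hs) (hFB 0 (by simp)))) (a := -(1 / 2)) (b := 1 / 2) le_rfl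
      (by norm_num) le_rfl
  have hone : ∀ x : ℝ, cscIntegral (fun _ => F 0) x = F 0 * cscIntegral (fun _ => 1) x := by
    intro x
    simp only [cscIntegral, ← integral_const_mul, mul_one_div]
  have hsub : ∀ M : ℤ, |(M + 1 / 2 : ℝ)| ≤ 1 / 2 →
      cscIntegral (fun s => F s - F 0) (M + 1 / 2) =
      cscIntegral F (M + 1 / 2) - cscIntegral (fun _ => F 0) (M + 1 / 2) := by
    intro M hM
    simp only [cscIntegral, sub_div]
    refine integral_sub ?_ ?_
    · exact integrable_vertical_div_sin hFd.continuous M (B := B) fun y => hFB _ (by simpa using hM)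
    · exact integrable_vertical_div_sin (f := fun _ => F 0) continuous_const M (B := B)
        fun y => hFB 0 (by simp)
  -- The values M = 0 and M = -1 give the lines Re s = 1/2 and Re s = -1/2.
  have h1 := hsub 0 (by norm_num)
  have h2 := hsub (-1) (by norm_num)
  norm_num at h1 h2 hg
  rw [h1, h2, hone, hone] at hg
  have e1 := cscIntegral_one_half
  have e2 := cscIntegral_one_neg_half
  norm_num at e1 e2
  rw [e1, e2] at hg
  have h3 := cscIntegral_int_add f N (1 / 2)
  have h4 := cscIntegral_int_add f N (-(1 / 2))
  have h5 : F 0 = f N := by simp [hF]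
  rw [sub_eq_add_neg (N : ℝ), h3, h4, ← h5]
  norm_num
  linear_combination (-(-1) ^ N) * hg

/-! ### Growth conditions and moving the line to the right. -/

/-- `f` is bounded on every vertical strip of finite width. -/
def StripBounded (f : ℂ → ℂ) : Prop := ∀ R : ℝ, ∃ B : ℝ, ∀ s : ℂ, |s.re| ≤ R → ‖f s‖ ≤ B

/-- `f` grows at most exponentially on every vertical strip of finite width. -/
def StripGrowth (f : ℂ → ℂ) : Prop :=
  ∀ R : ℝ, ∃ C A : ℝ, ∀ s : ℂ, |s.re| ≤ R → ‖f s‖ ≤ C * Real.exp (A * |s.im|)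

theorem StripGrowth.stripBounded_mul {f : ℂ → ℂ} (hf : StripGrowth f) {ε : ℝ} (hε : 0 < ε)
    (r : ℝ) : StripBounded fun s => f s * exp (ε * s ^ 2 + 2 * r * s) := by
  intro R
  obtain ⟨C, A, h⟩ := hf R
  refine ⟨C * Real.exp (A ^ 2 / (4 * ε) + ε * R ^ 2 + 2 * |r| * R), fun s hs => ?_⟩
  have hC : 0 ≤ C := by
    have := (norm_nonneg _).trans (h s hs)
    exact nonneg_of_mul_nonneg_left this (Real.exp_pos _)
  rw [norm_mul, Complex.norm_exp]
  have hre : ((ε : ℂ) * s ^ 2 + 2 * r * s).re = ε * (s.re ^ 2 - s.im ^ 2) + 2 * (r * s.re) := by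
    simp [sq]; ring
  rw [hre]
  calc ‖f s‖ * Real.exp (ε * (s.re ^ 2 - s.im ^ 2) + 2 * (r * s.re))
      ≤ C * Real.exp (A * |s.im|) * Real.exp (ε * (s.re ^ 2 - s.im ^ 2) + 2 * (r * s.re)) :=
        mul_le_mul_of_nonneg_right (h s hs) (Real.exp_pos _).le
    _ = C * Real.exp (A * |s.im| + (ε * (s.re ^ 2 - s.im ^ 2) + 2 * (r * s.re))) := by
        rw [mul_assoc, ← Real.exp_add]
    _ ≤ _ := by
        refine mul_le_mul_of_nonneg_left (Real.exp_le_exp.2 ?_) hC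
        have h1 : s.re ^ 2 ≤ R ^ 2 := by
          rw [← sq_abs]; exact pow_le_pow_left₀ (abs_nonneg _) hs 2
        have h2 : r * s.re ≤ |r| * R := by
          refine (le_abs_self _).trans ?_
          rw [abs_mul]
          exact mul_le_mul_of_nonneg_left hs (abs_nonneg _)
        -- Completing the square: exp(εs²) decays like exp(-ε y²) and beats the exponential growth.
        have h3 : A * |s.im| - ε * s.im ^ 2 ≤ A ^ 2 / (4 * ε) := by
          rw [le_div_iff₀ (by positivity), ← sq_abs s.im]
          nlinarith [sq_nonneg (A - 2 * ε * |s.im|)]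
        nlinarith [mul_le_mul_of_nonneg_left h1 hε.le]

theorem cscIntegral_half_line_shift {f : ℂ → ℂ} (hf : Differentiable ℂ f) (hb : StripBounded f)
    (M m : ℕ) : cscIntegral f ((M + m : ℕ) + 1 / 2) =
      cscIntegral f (M + 1 / 2) + 2 * ∑ n ∈ Finset.Ico (M + 1) (M + m + 1), (-1) ^ n * f n := by
  induction m with
  | zero => simp
  | succ m ih =>
    obtain ⟨B, hB⟩ := hb (M + m + 2)
    have h := cscIntegral_sub_cscIntegral hf ((M + m + 1 : ℕ) : ℤ) (B := B) (fun s hs => hB s (by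
      have := abs_le.1 hs
      push_cast at this
      rw [abs_le]
      constructor <;> linarith))
    have e : (((M + m + 1 : ℕ) : ℤ) : ℝ) - 1 / 2 = ((M + m : ℕ) : ℝ) + 1 / 2 := by
      push_cast; ring
    rw [e, ih] at h
    rw [← add_assoc, Finset.sum_Ico_succ_top (by omega)]
    simp only [Int.cast_natCast, zpow_natCast] at h
    rw [sub_eq_iff_eq_add.1 h]
    ring

/-- The bound on a line `Re s = N + 1/2` used for moving it to the right. -/
def LineBound (f : ℂ → ℂ) (x E : ℝ) : Prop :=
  ∀ y : ℝ, ‖f (x + y * I)‖ ≤ Real.cosh (Real.pi * y) / (1 + y ^ 2) * E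

theorem LineBound.norm_div_sin_le {f : ℂ → ℂ} {N : ℕ} {E : ℝ} (h : LineBound f (N + 1 / 2) E)
    (y : ℝ) : ‖f (((N + 1 / 2 : ℝ) : ℂ) + y * I) /
      sin (Real.pi * (((N + 1 / 2 : ℝ) : ℂ) + y * I))‖ ≤ E / (1 + y ^ 2) := by
  rw [norm_div, norm_sin_pi_mul_nat_add_half, div_le_iff₀ (Real.cosh_pos _)]
  refine (h y).trans (le_of_eq ?_)
  ring

theorem LineBound.norm_cscIntegral_le {f : ℂ → ℂ} {N : ℕ} {E : ℝ}
    (h : LineBound f (N + 1 / 2) E) : ‖cscIntegral f (N + 1 / 2)‖ ≤ E * Real.pi := by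
  refine (norm_integral_le_of_norm_le (integrable_const_div_one_add_sq E)
    (ae_of_all _ h.norm_div_sin_le)).trans (le_of_eq ?_)
  simp only [div_eq_mul_inv]
  rw [integral_const_mul, integral_univ_inv_one_add_sq]

theorem LineBound.mul_exp {f : ℂ → ℂ} {x E : ℝ} (h : LineBound f x E) (r : ℝ) :
    LineBound (fun s => f s * exp (2 * r * s)) x (E * Real.exp (2 * r * x)) := by
  intro y
  have hre : (2 * r * ((x : ℂ) + y * I)).re = 2 * r * x := by simp
  rw [norm_mul, Complex.norm_exp, hre, ← mul_assoc]
  exact mul_le_mul_of_nonneg_right (h y) (Real.exp_pos _).le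

/-- On a fixed line exp(εs²) has norm at most exp(ε (N + 1/2)²), so for ε < 1 dominated convergence
removes the regularization. -/
theorem LineBound.tendsto_cscIntegral_gauss {f : ℂ → ℂ} (hf : Continuous f) {N : ℕ} {E : ℝ}
    (h : LineBound f (N + 1 / 2) E) :
    Tendsto (fun ε : ℝ => cscIntegral (fun s => f s * exp (ε * s ^ 2)) (N + 1 / 2)) (𝓝[>] 0)
      (𝓝 (cscIntegral f (N + 1 / 2))) := by
  refine tendsto_integral_filter_of_dominated_convergence
    (fun y : ℝ => E * Real.exp ((N + 1 / 2) ^ 2) / (1 + y ^ 2)) ?_ ?_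
    (integrable_const_div_one_add_sq _) ?_
  · refine Eventually.of_forall fun ε => ?_
    have hc : Continuous fun s : ℂ => f s * exp (ε * s ^ 2) := by fun_prop
    exact (measurable_vertical_div_sin hc (N + 1 / 2)).aestronglyMeasurable
  · have h1 : ∀ᶠ ε : ℝ in 𝓝[>] 0, ε ∈ Ioo (0 : ℝ) 1 := Ioo_mem_nhdsGT one_pos
    filter_upwards [h1] with ε hε
    refine ae_of_all _ fun y => ?_
    rw [mul_div_right_comm, norm_mul, mul_div_right_comm]
    refine mul_le_mul (h.norm_div_sin_le y) ?_ (norm_nonneg _)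
      ((norm_nonneg _).trans (h.norm_div_sin_le y))
    rw [Complex.norm_exp]
    refine Real.exp_le_exp.2 ?_
    have : ((ε : ℂ) * (((N + 1 / 2 : ℝ) : ℂ) + y * I) ^ 2).re =
        ε * ((N + 1 / 2) ^ 2 - y ^ 2) := by
      rw [re_ofReal_mul]
      simp [sq]
    rw [this]
    nlinarith [mul_nonneg hε.1.le (sq_nonneg y),
      mul_le_mul_of_nonneg_right hε.2.le (sq_nonneg ((N : ℝ) + 1 / 2))]
  · refine ae_of_all _ fun y => ?_
    refine Tendsto.mono_left ?_ nhdsWithin_le_nhds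
    have : ∀ a b c : ℂ, Tendsto (fun ε : ℝ => a * exp (ε * b) / c) (𝓝 0) (𝓝 (a / c)) := by
      intro a b c
      have : Continuous fun ε : ℝ => a * exp (ε * b) / c := by fun_prop
      simpa using this.tendsto 0
    exact this _ _ _

/-- Moving the line `Re s = M + 1/2` to the right for a function with line bounds. -/
theorem cscIntegral_half_line_shift_of_lineBound {f : ℂ → ℂ} (hf : Differentiable ℂ f)
    (hg : StripGrowth f) {M : ℕ} {E : ℕ → ℝ}
    (hE : ∀ m : ℕ, LineBound f ((M + m : ℕ) + 1 / 2) (E m)) (r : ℝ) (m : ℕ) :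
    cscIntegral (fun s => f s * exp (2 * r * s)) ((M + m : ℕ) + 1 / 2) =
      cscIntegral (fun s => f s * exp (2 * r * s)) (M + 1 / 2) +
        2 * ∑ n ∈ Finset.Ico (M + 1) (M + m + 1), (-1) ^ n * (f n * exp (2 * r * n)) := by
  have hc : Continuous fun s => f s * exp (2 * r * s) := by
    have := hf.continuous; fun_prop
  have h1 := ((hE m).mul_exp r).tendsto_cscIntegral_gauss hc
  have h2 := ((hE 0).mul_exp r).tendsto_cscIntegral_gauss hc
  simp only [Nat.add_zero] at h2
  have h3 : Tendsto (fun ε : ℝ => 2 * ∑ n ∈ Finset.Ico (M + 1) (M + m + 1),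
      (-1 : ℂ) ^ n * (f n * exp (2 * r * n) * exp (ε * (n : ℂ) ^ 2))) (𝓝[>] 0)
      (𝓝 (2 * ∑ n ∈ Finset.Ico (M + 1) (M + m + 1), (-1 : ℂ) ^ n * (f n * exp (2 * r * n)))) := by
    refine Tendsto.mono_left ?_ nhdsWithin_le_nhds
    have : Continuous fun ε : ℝ => 2 * ∑ n ∈ Finset.Ico (M + 1) (M + m + 1),
      (-1 : ℂ) ^ n * (f n * exp (2 * r * n) * exp (ε * (n : ℂ) ^ 2)) := by fun_prop
    simpa using this.tendsto 0
  -- For each ε > 0 the factor exp(εs²) makes the function bounded on strips, so the shift is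
  -- legitimate. Both sides then converge as ε tends to 0, because both end lines carry line bounds.
  refine tendsto_nhds_unique h1 ((h2.add h3).congr' ?_)
  filter_upwards [self_mem_nhdsWithin] with ε hε
  have hb : StripBounded fun s => f s * exp (2 * r * s) * exp (ε * s ^ 2) := by
    have := hg.stripBounded_mul hε r
    refine fun R => (this R).imp fun B hB s hs => ?_
    have h := hB s hs
    simp only [add_comm ((ε : ℂ) * s ^ 2), Complex.exp_add, ← mul_assoc] at h ⊢
    exact h
  exact (cscIntegral_half_line_shift (by fun_prop) hb M m).symm

/-- Closing the line `Re s = M + 1/2` to the right. -/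
theorem tendsto_sum_of_lineBound {f : ℂ → ℂ} (hf : Differentiable ℂ f)
    (hg : StripGrowth f) {M : ℕ} {E : ℕ → ℝ}
    (hE : ∀ m : ℕ, LineBound f ((M + m : ℕ) + 1 / 2) (E m))
    (hlim : ∀ x : ℝ, Tendsto (fun m : ℕ => E m * Real.exp (x * m)) atTop (𝓝 0)) (r : ℝ) :
    Tendsto (fun m : ℕ => ∑ n ∈ Finset.Ico (M + 1) (M + m + 1),
        (-1) ^ n * (f n * exp (2 * r * n))) atTop
      (𝓝 (-(1 / 2) * cscIntegral (fun s => f s * exp (2 * r * s)) (M + 1 / 2))) := by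
  have h1 : Tendsto (fun m : ℕ => cscIntegral (fun s => f s * exp (2 * r * s))
      ((M + m : ℕ) + 1 / 2)) atTop (𝓝 0) := by
    refine squeeze_zero_norm (fun m => ((hE m).mul_exp r).norm_cscIntegral_le) ?_
    have := (hlim (2 * r)).mul_const (Real.exp (2 * r * (M + 1 / 2)) * Real.pi)
    rw [zero_mul] at this
    refine this.congr fun m => ?_
    have : Real.exp (2 * r * ((M + m : ℕ) + 1 / 2)) =
        Real.exp (2 * r * m) * Real.exp (2 * r * (M + 1 / 2)) := by
      rw [← Real.exp_add]; push_cast; ring_nf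
    rw [this]; ring
  have h2 := (h1.sub_const (cscIntegral (fun s => f s * exp (2 * r * s)) (M + 1 / 2))).const_mul
    (1 / 2 : ℂ)
  convert h2.congr fun m => ?_ using 2
  · ring
  · rw [cscIntegral_half_line_shift_of_lineBound hf hg hE r m]
    ring

/-! ### Gaussian averages over `r` of series over the integers. -/

/-- The Gaussian `exp((s/K)²)`. -/
def gauss (K : ℝ) (s : ℂ) : ℂ := exp (((K ^ 2)⁻¹ : ℝ) * s ^ 2)

theorem differentiable_gauss (K : ℝ) : Differentiable ℂ (gauss K) := by
  unfold gauss; fun_prop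

theorem gauss_neg (K : ℝ) (s : ℂ) : gauss K (-s) = gauss K s := by simp [gauss]

theorem gauss_zero (K : ℝ) : gauss K 0 = 1 := by simp [gauss]

theorem StripGrowth.stripBounded_mul_gauss {f : ℂ → ℂ} (hf : StripGrowth f) {K : ℝ} (hK : 0 < K) :
    StripBounded fun s => f s * gauss K s := by
  have h := hf.stripBounded_mul (ε := (K ^ 2)⁻¹) (by positivity) 0
  simp only [ofReal_zero, mul_zero, zero_mul, add_zero] at h
  exact h

theorem kFun_mul_exp_eq {K : ℝ} (r : ℝ) (s : ℂ) :
    (kFun K r : ℂ) * exp (2 * r * s) =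
      (Real.sqrt Real.pi * K : ℝ) * exp (-(K ^ 2 : ℝ) * r ^ 2 + 2 * s * r + 0) := by
  rw [kFun, ofReal_mul, mul_assoc, ofReal_exp, ← Complex.exp_add]
  congr 2
  push_cast
  ring

theorem integrable_kFun_mul_cexp {K : ℝ} (hK : 0 < K) (s : ℂ) :
    Integrable fun r : ℝ => (kFun K r : ℂ) * exp (2 * r * s) := by
  simp only [kFun_mul_exp_eq]
  refine Integrable.const_mul (integrable_cexp_quadratic ?_ _ _) _
  rw [ofReal_re]
  positivity

/-- This Laplace transform ties `kFun` to the weight: at s = iκ the right side is π exp(-(κ/K)²). -/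
theorem integral_kFun_mul_cexp {K : ℝ} (hK : 0 < K) (s : ℂ) :
    ∫ r : ℝ, (kFun K r : ℂ) * exp (2 * r * s) = Real.pi * gauss K s := by
  simp only [kFun_mul_exp_eq]
  rw [integral_const_mul, integral_cexp_quadratic (b := -((K ^ 2 : ℝ) : ℂ)) (by
    rw [← ofReal_neg, ofReal_re]; exact neg_lt_zero.2 (by positivity)),
    ← mul_assoc]
  have h1 : ((Real.pi : ℂ) / -(-(K ^ 2 : ℝ))) ^ (1 / 2 : ℂ) = (Real.sqrt Real.pi / K : ℝ) := by
    rw [neg_neg, ← ofReal_div, show (1 / 2 : ℂ) = ((1 / 2 : ℝ) : ℂ) by norm_num,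
      ← ofReal_cpow (by positivity), ← Real.sqrt_eq_rpow, Real.sqrt_div Real.pi_pos.le,
      Real.sqrt_sq hK.le]
  rw [h1, ← ofReal_mul]
  have h2 : Real.sqrt Real.pi * K * (Real.sqrt Real.pi / K) = Real.pi := by
    have := Real.mul_self_sqrt Real.pi_pos.le
    field_simp
    nlinarith
  rw [h2, gauss]
  congr 2
  have : (K : ℂ) ≠ 0 := ofReal_ne_zero.2 hK.ne'
  push_cast
  field_simp
  ring

theorem kFun_nonneg {K : ℝ} (hK : 0 < K) (r : ℝ) : 0 ≤ kFun K r := by unfold kFun; positivity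

theorem kFun_neg (K r : ℝ) : kFun K (-r) = kFun K r := by simp [kFun]

theorem continuous_kFun (K : ℝ) : Continuous (kFun K) := by unfold kFun; fun_prop

theorem integrable_kFun_mul_exp {K : ℝ} (hK : 0 < K) (x : ℝ) :
    Integrable fun r : ℝ => kFun K r * Real.exp (2 * r * x) := by
  have := (integrable_kFun_mul_cexp hK x).norm
  refine this.congr (ae_of_all _ fun r => ?_)
  have h : ((2 : ℂ) * r * x).re = 2 * r * x := by simp
  simp only [norm_mul, Complex.norm_exp, norm_real, Real.norm_of_nonneg (kFun_nonneg hK r), h]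

/-- On the line, e^{2rs} has norm e^{2r(N + 1/2)}, independent of `y`. The dominating function is
therefore a product of a function of `r` and E / (1 + y²), which justifies Fubini. -/
theorem integrable_prod_kFun_mul_div_sin {f : ℂ → ℂ} (hf : Continuous f) {N : ℕ} {E : ℝ}
    (h : LineBound f (N + 1 / 2) E) {K : ℝ} (hK : 0 < K) :
    Integrable (fun q : ℝ × ℝ => (kFun K q.1 : ℂ) *
      (f (((N + 1 / 2 : ℝ) : ℂ) + q.2 * I) * exp (2 * q.1 * (((N + 1 / 2 : ℝ) : ℂ) + q.2 * I)) /
        sin (Real.pi * (((N + 1 / 2 : ℝ) : ℂ) + q.2 * I)))) := by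
  refine ((integrable_kFun_mul_exp hK (N + 1 / 2)).mul_prod
    (integrable_const_div_one_add_sq E)).mono' ?_ (ae_of_all _ fun q => ?_)
  · refine Measurable.aestronglyMeasurable ?_
    have h1 : Continuous fun q : ℝ × ℝ => f (((N + 1 / 2 : ℝ) : ℂ) + q.2 * I) *
        exp (2 * q.1 * (((N + 1 / 2 : ℝ) : ℂ) + q.2 * I)) :=
      (hf.comp (by fun_prop)).mul (by fun_prop)
    have h2 : Continuous fun q : ℝ × ℝ => sin (Real.pi * (((N + 1 / 2 : ℝ) : ℂ) + q.2 * I)) := by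
      fun_prop
    have h3 : Continuous fun q : ℝ × ℝ => (kFun K q.1 : ℂ) :=
      continuous_ofReal.comp ((continuous_kFun K).comp continuous_fst)
    exact h3.measurable.mul (h1.measurable.div h2.measurable)
  · have hre : (2 * q.1 * (((N + 1 / 2 : ℝ) : ℂ) + q.2 * I)).re = 2 * q.1 * (N + 1 / 2) := by
      simp
    rw [norm_mul, mul_div_right_comm, norm_mul, Complex.norm_exp, hre, norm_real,
      Real.norm_of_nonneg (kFun_nonneg hK _), mul_assoc (kFun K q.1),
      mul_comm (Real.exp _)]
    exact mul_le_mul_of_nonneg_left (mul_le_mul_of_nonneg_right (h.norm_div_sin_le _)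
      (Real.exp_pos _).le) (kFun_nonneg hK _)

theorem integrable_kFun_mul_cscIntegral {f : ℂ → ℂ} (hf : Continuous f) {N : ℕ} {E : ℝ}
    (h : LineBound f (N + 1 / 2) E) {K : ℝ} (hK : 0 < K) :
    Integrable fun r : ℝ => (kFun K r : ℂ) *
      cscIntegral (fun s => f s * exp (2 * r * s)) (N + 1 / 2) := by
  have := (integrable_prod_kFun_mul_div_sin hf h hK).integral_prod_left
  simp only [integral_const_mul] at this
  exact this

theorem integral_kFun_mul_cscIntegral {f : ℂ → ℂ} (hf : Continuous f) {N : ℕ} {E : ℝ}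
    (h : LineBound f (N + 1 / 2) E) {K : ℝ} (hK : 0 < K) :
    ∫ r : ℝ, (kFun K r : ℂ) * cscIntegral (fun s => f s * exp (2 * r * s)) (N + 1 / 2) =
      Real.pi * cscIntegral (fun s => f s * gauss K s) (N + 1 / 2) := by
  have := integral_integral_swap (f := fun r y : ℝ => (kFun K r : ℂ) *
      (f (((N + 1 / 2 : ℝ) : ℂ) + y * I) * exp (2 * r * (((N + 1 / 2 : ℝ) : ℂ) + y * I)) /
        sin (Real.pi * (((N + 1 / 2 : ℝ) : ℂ) + y * I))))
    (integrable_prod_kFun_mul_div_sin hf h hK)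
  simp only [integral_const_mul] at this
  refine this.trans ?_
  rw [cscIntegral, ← integral_const_mul]
  refine integral_congr_ae (ae_of_all _ fun y => ?_)
  simp only
  rw [← mul_div_assoc, mul_left_comm, ← integral_kFun_mul_cexp hK, ← integral_const_mul,
    ← integral_div]
  refine integral_congr_ae (ae_of_all _ fun r => ?_)
  simp only
  ring

/-- The hypotheses under which the sum over the integers to the right of a line is an integral
along the line. -/
structure MellinClass (f : ℂ → ℂ) : Prop where
  differentiable : Differentiable ℂ f
  growth : StripGrowth f
  lines : ∃ (M : ℕ) (E : ℕ → ℝ), (∀ m : ℕ, LineBound f ((M + m : ℕ) + 1 / 2) (E m)) ∧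
    ∀ x : ℝ, Tendsto (fun m : ℕ => E m * Real.exp (x * m)) atTop (𝓝 0)

/-- For fixed `r` the series can be closed only from a line Re s = M + 1/2 far to the right, where
line bounds hold; the terms n ≤ M are kept as a finite sum. Integration over `r` turns e^{2rs} into
π exp((s/K)²), and the finite sum is then absorbed by moving the line back to 1/2. -/
theorem MellinClass.integral_kFun_mul {f : ℂ → ℂ} (hf : MellinClass f) {K : ℝ} (hK : 0 < K)
    {S : ℝ → ℂ} (hS : ∀ r : ℝ,
      HasSum (fun n : ℕ => (-1) ^ (n + 1) * (f (n + 1 : ℕ) * exp (2 * r * (n + 1 : ℕ)))) (S r)) :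
    (Integrable fun r : ℝ => (kFun K r : ℂ) * S r) ∧
    ∫ r : ℝ, (kFun K r : ℂ) * S r =
      -(Real.pi / 2) * cscIntegral (fun s => f s * gauss K s) (1 / 2) := by
  obtain ⟨M, E, hE, hlim⟩ := hf.lines
  have hc := hf.differentiable.continuous
  have hE0 : LineBound f (M + 1 / 2) (E 0) := by simpa using hE 0
  have hSr : ∀ r : ℝ, S r = (∑ n ∈ Finset.Ico 1 (M + 1), (-1) ^ n * (f n * exp (2 * r * n))) +
      -(1 / 2) * cscIntegral (fun s => f s * exp (2 * r * s)) (M + 1 / 2) := by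
    intro r
    have h1 := tendsto_sum_of_lineBound hf.differentiable hf.growth hE hlim r
    have h2 := h1.const_add (∑ n ∈ Finset.Ico 1 (M + 1), (-1) ^ n * (f n * exp (2 * r * n)))
    have h3 := ((hS r).tendsto_sum_nat.comp (tendsto_add_atTop_nat M))
    refine tendsto_nhds_unique h3 (h2.congr fun m => ?_)
    rw [Finset.sum_Ico_consecutive _ (by omega) (by omega), Finset.sum_Ico_eq_sum_range]
    simp only [Function.comp_apply]
    refine Finset.sum_congr (by congr 1; omega) fun n _ => ?_
    rw [add_comm 1 n]
  have hk : ∀ r : ℝ, (kFun K r : ℂ) * S r =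
      (∑ n ∈ Finset.Ico 1 (M + 1), (-1) ^ n * f n * ((kFun K r : ℂ) * exp (2 * r * n))) +
      -(1 / 2) * ((kFun K r : ℂ) *
        cscIntegral (fun s => f s * exp (2 * r * s)) (M + 1 / 2)) := by
    intro r
    rw [hSr, mul_add, Finset.mul_sum]
    congr 1
    · exact Finset.sum_congr rfl fun n _ => by ring
    · ring
  have hi1 : ∀ n ∈ Finset.Ico 1 (M + 1), Integrable fun r : ℝ =>
      (-1) ^ n * f n * ((kFun K r : ℂ) * exp (2 * r * n)) := fun n _ =>
    (integrable_kFun_mul_cexp hK n).const_mul _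
  have hi2 := (integrable_kFun_mul_cscIntegral hc hE0 hK).const_mul (-(1 / 2) : ℂ)
  simp only [hk]
  refine ⟨(integrable_finsetSum _ hi1).add hi2, ?_⟩
  rw [integral_add (integrable_finsetSum _ hi1) hi2, integral_finsetSum _ hi1,
    integral_const_mul, integral_kFun_mul_cscIntegral hc hE0 hK]
  -- With the Gaussian present the integrand is bounded on every strip, so no line bound is needed
  -- between 1/2 and M + 1/2.
  have hshift := cscIntegral_half_line_shift (f := fun s => f s * gauss K s)
    (hf.differentiable.mul (differentiable_gauss K)) (hf.growth.stripBounded_mul_gauss hK) 0 M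
  simp only [zero_add, Nat.cast_zero] at hshift
  rw [hshift]
  simp only [integral_const_mul, integral_kFun_mul_cexp hK]
  have : ∑ n ∈ Finset.Ico 1 (M + 1), (-1 : ℂ) ^ n * f n * (Real.pi * gauss K n) =
      Real.pi * ∑ n ∈ Finset.Ico 1 (M + 1), (-1 : ℂ) ^ n * (f n * gauss K n) := by
    rw [Finset.mul_sum]
    exact Finset.sum_congr rfl fun n _ => by ring
  rw [this]
  ring

theorem cscIntegral_comp_neg (f : ℂ → ℂ) (x : ℝ) :
    cscIntegral (fun s => f (-s)) (-x) = -cscIntegral f x := by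
  unfold cscIntegral
  rw [← integral_neg_eq_self, ← integral_neg]
  refine integral_congr_ae (ae_of_all _ fun y => ?_)
  have h : (((-x : ℝ) : ℂ) + ((-y : ℝ) : ℂ) * I) = -(x + y * I) := by push_cast; ring
  simp only
  rw [h, neg_neg, mul_neg, Complex.sin_neg, div_neg]

/-- Integrating a two-sided series against a Gaussian gives an integral along the imaginary axis. -/
theorem integral_kFun_mul_two_sided {f g : ℂ → ℂ} (hf : MellinClass f) (hg : MellinClass g)
    (hfg : ∀ n : ℕ, f (-n) = g n) {K : ℝ} (hK : 0 < K) {S : ℝ → ℂ}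
    (hS : ∀ r : ℝ, HasSum (fun n : ℤ => (-1) ^ n * (f n * exp (2 * r * n))) (S r)) :
    (Integrable fun r : ℝ => (kFun K r : ℂ) * S r) ∧
    ∫ r : ℝ, (kFun K r : ℂ) * S r =
      Real.pi / 2 * cscIntegral (fun s => (g (-s) - f s) * gauss K s) 0 := by
  have hsum : ∀ r : ℝ, Summable fun n : ℤ => (-1) ^ n * (f n * exp (2 * r * n)) := fun r =>
    (hS r).summable
  set S1 : ℝ → ℂ := fun r => ∑' n : ℕ, (-1) ^ (n + 1) * (f (n + 1 : ℕ) *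
    exp (2 * r * (n + 1 : ℕ))) with hS1
  set S2 : ℝ → ℂ := fun r => ∑' n : ℕ, (-1) ^ (n + 1) * (g (n + 1 : ℕ) *
    exp (2 * r * (n + 1 : ℕ))) with hS2
  have F1 : ∀ (r : ℝ) (n : ℕ), (-1 : ℂ) ^ (((n + 1 : ℕ) : ℤ)) * (f ((n + 1 : ℕ) : ℤ) *
      exp (2 * r * ((n + 1 : ℕ) : ℤ))) =
      (-1) ^ (n + 1) * (f (n + 1 : ℕ) * exp (2 * r * (n + 1 : ℕ))) := by
    intro r n
    rw [zpow_natCast, Int.cast_natCast]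
  have F2 : ∀ (r : ℝ) (n : ℕ), (-1 : ℂ) ^ (-((n + 1 : ℕ) : ℤ)) *
      (f ((-((n + 1 : ℕ) : ℤ) : ℤ) : ℂ) * exp (2 * (-r : ℝ) * ((-((n + 1 : ℕ) : ℤ) : ℤ) : ℂ))) =
      (-1) ^ (n + 1) * (g (n + 1 : ℕ) * exp (2 * r * (n + 1 : ℕ))) := by
    intro r n
    rw [zpow_neg, zpow_natCast, ← inv_pow, inv_neg, inv_one, Int.cast_neg, Int.cast_natCast, hfg]
    push_cast
    ring_nf
  have h1 : ∀ r : ℝ, HasSum (fun n : ℕ => (-1) ^ (n + 1) * (f (n + 1 : ℕ) *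
      exp (2 * r * (n + 1 : ℕ)))) (S1 r) := by
    intro r
    have hinj : Function.Injective fun n : ℕ => ((n + 1 : ℕ) : ℤ) := fun a b h => by
      simpa using h
    exact (((hsum r).comp_injective hinj).congr fun n => (F1 r n).symm).hasSum
  have h2 : ∀ r : ℝ, HasSum (fun n : ℕ => (-1) ^ (n + 1) * (g (n + 1 : ℕ) *
      exp (2 * r * (n + 1 : ℕ)))) (S2 r) := by
    intro r
    have hinj : Function.Injective fun n : ℕ => -((n + 1 : ℕ) : ℤ) := fun a b h => by
      simpa using h
    refine Summable.hasSum (Summable.congr ((hsum (-r)).comp_injective hinj) fun n => ?_)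
    exact F2 r n
  have hSr : ∀ r, S r = f 0 + S1 r + S2 (-r) := by
    intro r
    have ha := (hasSum_nat_add_iff (f := fun n : ℕ => (-1 : ℂ) ^ (n : ℤ) * (f (n : ℤ) *
      exp (2 * r * (n : ℤ)))) 1).1 (by simpa only [F1] using h1 r)
    have hb : HasSum (fun n : ℕ => (-1 : ℂ) ^ (-((n : ℤ) + 1)) *
        (f ((-((n : ℤ) + 1) : ℤ) : ℂ) * exp (2 * r * ((-((n : ℤ) + 1) : ℤ) : ℂ)))) (S2 (-r)) := by
      have := h2 (-r)
      simp only [← F2, neg_neg] at this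
      exact_mod_cast this
    have hab := HasSum.of_nat_of_neg_add_one (f := fun n : ℤ => (-1 : ℂ) ^ n *
      (f n * exp (2 * r * n))) ha hb
    rw [(hS r).unique hab]
    simp
    ring
  obtain ⟨i1, e1⟩ := hf.integral_kFun_mul hK h1
  obtain ⟨i2, e2⟩ := hg.integral_kFun_mul hK h2
  have i3 : Integrable fun r : ℝ => (kFun K r : ℂ) * S2 (-r) := by
    have := i2.comp_neg
    simpa only [kFun_neg] using this
  have e3 : ∫ r : ℝ, (kFun K r : ℂ) * S2 (-r) = ∫ r : ℝ, (kFun K r : ℂ) * S2 r := by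
    rw [← integral_neg_eq_self]
    simp only [kFun_neg, neg_neg]
  have i0 : Integrable fun r : ℝ => (kFun K r : ℂ) * f 0 := by
    have := (integrable_kFun_mul_cexp hK 0).mul_const (f 0)
    simpa using this
  have e0 : ∫ r : ℝ, (kFun K r : ℂ) * f 0 = Real.pi * f 0 := by
    have := integral_kFun_mul_cexp hK 0
    rw [integral_mul_const]
    simp only [mul_zero, Complex.exp_zero, mul_one, gauss_zero] at this
    rw [this]
  simp only [hSr, mul_add]
  refine ⟨(i0.add i1).add i3, ?_⟩
  rw [integral_add (f := fun r : ℝ => (kFun K r : ℂ) * f 0 + kFun K r * S1 r) (i0.add i1) i3,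
    integral_add i0 i1, e0, e1, e3, e2]
  have hfb := hf.growth.stripBounded_mul_gauss hK
  have hgb := hg.growth.stripBounded_mul_gauss hK
  have hgb' : ∀ R : ℝ, ∃ B : ℝ, ∀ s : ℂ, |s.re| ≤ R → ‖g (-s) * gauss K s‖ ≤ B := fun R =>
    (hgb R).imp fun B hB s hs => by simpa [gauss_neg] using hB (-s) (by simpa using hs)
  obtain ⟨Bf, hBf⟩ := hfb (1 / 2)
  obtain ⟨Bg, hBg⟩ := hgb' (1 / 2)
  have hfd := hf.differentiable
  have hgd := hg.differentiable
  have hKd := differentiable_gauss K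
  have hfg0 : f 0 = g 0 := by simpa using hfg 0
  -- The numerator vanishes at 0 because f(0) = g(0), so the imaginary axis may be moved to Re s =
  -- 1/2, where the two terms can be separated.
  have t1 : cscIntegral (fun s => (g (-s) - f s) * gauss K s) 0 =
      cscIntegral (fun s => (g (-s) - f s) * gauss K s) (1 / 2) :=
    cscIntegral_eq_of_apply_zero (by fun_prop) (by simp [hfg0]) (B := Bg + Bf)
      (fun s hs => by
        rw [sub_mul]
        exact (norm_sub_le _ _).trans (add_le_add (hBg s hs) (hBf s hs)))
      (by norm_num) (by norm_num) le_rfl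
  have t2 : cscIntegral (fun s => (g (-s) - f s) * gauss K s) (1 / 2) =
      cscIntegral (fun s => g (-s) * gauss K s) (1 / 2) -
      cscIntegral (fun s => f s * gauss K s) (1 / 2) := by
    have j1 := integrable_vertical_div_sin (f := fun s => g (-s) * gauss K s)
      (by fun_prop : Differentiable ℂ fun s => g (-s) * gauss K s).continuous 0 (B := Bg)
      (fun y => hBg _ (by norm_num))
    have j2 := integrable_vertical_div_sin (f := fun s => f s * gauss K s)
      (by fun_prop : Differentiable ℂ fun s => f s * gauss K s).continuous 0 (B := Bf)
      (fun y => hBf _ (by norm_num))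
    simp only [Int.cast_zero, zero_add] at j1 j2
    rw [cscIntegral, cscIntegral, cscIntegral, ← integral_sub j1 j2]
    simp only [sub_mul, sub_div]
  -- Carrying g(-s) from 1/2 to -1/2 crosses the pole at 0, and its residue accounts for the term n
  -- = 0 of the series.
  have t3 := cscIntegral_sub_cscIntegral (f := fun s => g (-s) * gauss K s) (by fun_prop) 0
    (B := Bg) (fun s hs => hBg s (by simpa using hs))
  have t4 : cscIntegral (fun s => g (-s) * gauss K s) (-(1 / 2)) =
      -cscIntegral (fun s => g s * gauss K s) (1 / 2) := by
    rw [← cscIntegral_comp_neg]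
    simp only [gauss_neg]
  simp only [Int.cast_zero, zero_add, zero_sub, zpow_zero, mul_one, neg_zero, gauss_zero, t4] at t3
  rw [t1, t2, hfg0]
  linear_combination (-(Real.pi : ℂ) / 2) * t3

/-! ### Bounds for 1/Γ. -/

theorem norm_cos_le_exp (w : ℂ) : ‖cos w‖ ≤ Real.exp |w.im| := by
  rw [Complex.cos, norm_div, Complex.norm_ofNat, div_le_iff₀ two_pos]
  refine (norm_add_le _ _).trans ?_
  rw [Complex.norm_exp, Complex.norm_exp]
  have h1 : Real.exp (w * I).re ≤ Real.exp |w.im| :=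
    Real.exp_le_exp.2 (by simpa using neg_le_abs w.im)
  have h2 : Real.exp (-w * I).re ≤ Real.exp |w.im| :=
    Real.exp_le_exp.2 (by simpa using le_abs_self w.im)
  linarith

/-- Mean value inequality for the sine on a horizontal strip. The factor ‖w‖ cancels the denominator
of sin(πt) / (πt) in the reflection formula. -/
theorem norm_sin_le_mul_exp (w : ℂ) : ‖sin w‖ ≤ ‖w‖ * Real.exp |w.im| := by
  have hconv : Convex ℝ {s : ℂ | |s.im| ≤ |w.im|} := by
    have : {s : ℂ | |s.im| ≤ |w.im|} = Complex.imLm ⁻¹' (Icc (-|w.im|) |w.im|) := by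
      ext s; simp [abs_le]
    rw [this]
    exact (convex_Icc _ _).linear_preimage _
  have := hconv.norm_image_sub_le_of_norm_deriv_le (f := sin) (C := Real.exp |w.im|) (x := 0)
    (y := w) (fun s _ => Complex.differentiable_sin s) (fun s hs => by
      rw [Complex.deriv_sin]
      exact (norm_cos_le_exp s).trans (Real.exp_le_exp.2 hs)) (by simp) (by simp)
  simpa [mul_comm] using this

theorem norm_Gamma_le_Gamma_re {s : ℂ} (hs : 0 < s.re) : ‖Gamma s‖ ≤ Real.Gamma s.re := by
  rw [Complex.Gamma_eq_integral hs, Real.Gamma_eq_integral hs, Complex.GammaIntegral]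
  refine (norm_integral_le_integral_norm _).trans (le_of_eq ?_)
  refine setIntegral_congr_fun measurableSet_Ioi fun x hx => ?_
  rw [norm_mul, norm_real, Real.norm_of_nonneg (Real.exp_pos _).le,
    Complex.norm_cpow_eq_rpow_re_of_pos hx]
  simp

/-- With t = 1 - s, reflection gives 1/Γ(s) = Γ(1 + t) sin(πt) / (πt). Here Re(1 + t) lies in [1/2,
B + 2], where convexity bounds the real Gamma function by its values √π and (B + 1)! at the ends.
The point s = 1 is separate because t = 0 there. -/
theorem norm_inv_Gamma_le_of_re_le {B : ℕ} {s : ℂ} (h1 : -(B : ℝ) ≤ s.re) (h2 : s.re ≤ 3 / 2) :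
    ‖(Gamma s)⁻¹‖ ≤ 2 * (B + 1).factorial * Real.exp (Real.pi * |s.im|) := by
  have hfac : (1 : ℝ) ≤ ((B + 1).factorial : ℝ) := by
    exact_mod_cast Nat.one_le_iff_ne_zero.2 (Nat.factorial_ne_zero _)
  have hexp : 1 ≤ Real.exp (Real.pi * |s.im|) := Real.one_le_exp (by positivity)
  by_cases ht : s = 1
  · rw [ht, Complex.Gamma_one]; simp; nlinarith
  have ht' : 1 - s ≠ 0 := sub_ne_zero.2 (Ne.symm ht)
  have hpi : (Real.pi : ℂ) ≠ 0 := ofReal_ne_zero.2 Real.pi_ne_zero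
  have hrefl := Complex.Gamma_mul_Gamma_one_sub (1 - s)
  rw [sub_sub_cancel] at hrefl
  have hG : Gamma (1 + (1 - s)) = (1 - s) * Gamma (1 - s) := by
    rw [add_comm, Complex.Gamma_add_one _ ht']
  have hre : (1 + (1 - s)).re = 2 - s.re := by simp; ring
  have hub : ‖Gamma (1 + (1 - s))‖ ≤ 2 * (B + 1).factorial := by
    refine (norm_Gamma_le_Gamma_re (by rw [hre]; linarith)).trans ?_
    rw [hre]
    have hB : (0 : ℝ) ≤ B := Nat.cast_nonneg B
    have hmax := Real.convexOn_Gamma.le_max_of_mem_Icc (x := (1 / 2 : ℝ)) (y := ((B + 1 : ℕ) : ℝ) + 1)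
      (z := 2 - s.re) (by simp) (by simp; positivity)
      ⟨by linarith, by push_cast; linarith⟩
    refine hmax.trans (max_le ?_ ?_)
    · rw [Real.Gamma_one_half_eq]
      have : Real.sqrt Real.pi ≤ 2 := by
        rw [Real.sqrt_le_left (by norm_num)]
        linarith [Real.pi_le_four]
      linarith
    · rw [Real.Gamma_nat_eq_factorial]; linarith
  have hsin : ‖sin (Real.pi * (1 - s))‖ ≤
      ‖(Real.pi : ℂ) * (1 - s)‖ * Real.exp (Real.pi * |s.im|) := by
    have := norm_sin_le_mul_exp (Real.pi * (1 - s))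
    simpa [abs_mul, abs_of_pos Real.pi_pos] using this
  by_cases hs0 : Gamma s = 0
  · rw [hs0]; simp; positivity
  have hsne : sin (Real.pi * (1 - s)) ≠ 0 ∨ sin (Real.pi * (1 - s)) = 0 := (em _).symm
  rcases hsne with hsne | hsne
  · have key : (Gamma s)⁻¹ = Gamma (1 + (1 - s)) * (sin (Real.pi * (1 - s)) /
        (Real.pi * (1 - s))) := by
      rw [hG]
      rw [eq_div_iff hsne] at hrefl
      generalize sin (Real.pi * (1 - s)) = S at hrefl
      field_simp
      linear_combination -hrefl
    rw [key, norm_mul, norm_div]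
    refine mul_le_mul hub ?_ (by positivity) (by positivity)
    rw [div_le_iff₀ (norm_pos_iff.2 (mul_ne_zero hpi ht')),
      mul_comm (Real.exp _)]
    exact hsin
  · rw [hsne, div_zero, mul_eq_zero] at hrefl
    have h0 : Gamma (1 - s) = 0 := hrefl.resolve_right hs0
    obtain ⟨m, hm⟩ := (Complex.Gamma_eq_zero_iff _).1 h0
    have hsm : s = (m : ℂ) + 1 := by linear_combination -hm
    have hm1 : m = 0 := by
      rw [hsm] at h2
      simp at h2
      have : (m : ℝ) < 1 := by linarith
      exact_mod_cast Nat.lt_one_iff.1 (by exact_mod_cast this)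
    simp [hsm, hm1] at ht

/-- Induction by Γ(s) = (s - 1) Γ(s - 1). The first step divides by a number of norm at least 1/2
and doubles the constant; all later steps divide by one of norm at least 1. -/
theorem norm_inv_Gamma_le_of_half_le {s : ℂ} (hs : 1 / 2 ≤ s.re) :
    ‖(Gamma s)⁻¹‖ ≤ 4 * Real.exp (Real.pi * |s.im|) := by
  have key : ∀ (n : ℕ) (s : ℂ), 1 / 2 + n ≤ s.re → s.re ≤ 3 / 2 + n →
      ‖(Gamma s)⁻¹‖ ≤ (if n = 0 then 2 else 4) * Real.exp (Real.pi * |s.im|) := by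
    intro n
    induction n with
    | zero =>
      intro s h1 h2
      have := norm_inv_Gamma_le_of_re_le (B := 0) (s := s) (by simp at h1 ⊢; linarith)
        (by simpa using h2)
      simpa using this
    | succ n ih =>
      intro s h1 h2
      push_cast at h1 h2
      have h := ih (s - 1) (by simp; linarith) (by simp; linarith)
      have hn : (0 : ℝ) ≤ n := Nat.cast_nonneg n
      have hne : s - 1 ≠ 0 := by
        intro h0
        have := congrArg Complex.re h0
        simp at this
        linarith
      have hG : Gamma s = (s - 1) * Gamma (s - 1) := by
        rw [← Complex.Gamma_add_one _ hne, sub_add_cancel]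
      have hre : s.re - 1 ≤ ‖s - 1‖ := by simpa using Complex.re_le_norm (s - 1)
      have him : (s - 1).im = s.im := by simp
      rw [him] at h
      have hpos : 0 < ‖s - 1‖ := norm_pos_iff.2 hne
      have hexp := Real.exp_pos (Real.pi * |s.im|)
      rw [hG, mul_inv, norm_mul, norm_inv (s - 1), inv_mul_le_iff₀ hpos]
      rw [if_neg (Nat.succ_ne_zero n)]
      refine h.trans ?_
      rw [← mul_assoc]
      refine mul_le_mul_of_nonneg_right ?_ hexp.le
      split_ifs with h0
      · subst h0; push_cast at h1; linarith
      · have : (1 : ℝ) ≤ n := by exact_mod_cast Nat.one_le_iff_ne_zero.2 h0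
        linarith
  set n := ⌊s.re - 1 / 2⌋₊ with hn
  have h1 := Nat.floor_le (sub_nonneg.2 hs)
  have h2 := Nat.lt_floor_add_one (s.re - 1 / 2)
  refine (key n s (by linarith) (by linarith)).trans ?_
  have hexp := Real.exp_pos (Real.pi * |s.im|)
  split_ifs <;> nlinarith

theorem norm_inv_Gamma_le {B : ℕ} {s : ℂ} (h : -(B : ℝ) ≤ s.re) :
    ‖(Gamma s)⁻¹‖ ≤ 4 * (B + 1).factorial * Real.exp (Real.pi * |s.im|) := by
  have hfac : (1 : ℝ) ≤ ((B + 1).factorial : ℝ) := by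
    exact_mod_cast Nat.one_le_iff_ne_zero.2 (Nat.factorial_ne_zero _)
  have hexp := Real.exp_pos (Real.pi * |s.im|)
  rcases le_total s.re (3 / 2) with h' | h'
  · refine (norm_inv_Gamma_le_of_re_le h h').trans ?_
    nlinarith [mul_nonneg (zero_le_one.trans hfac) hexp.le]
  · refine (norm_inv_Gamma_le_of_half_le (by linarith)).trans ?_
    nlinarith

theorem norm_Gamma_half_sq (y : ℝ) :
    ‖Gamma (((1 / 2 : ℝ) : ℂ) + y * I)‖ ^ 2 = Real.pi / Real.cosh (Real.pi * y) := by
  have h := Complex.Gamma_mul_Gamma_one_sub (((1 / 2 : ℝ) : ℂ) + y * I)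
  have hc : (1 : ℂ) - (((1 / 2 : ℝ) : ℂ) + y * I) =
      (starRingEnd ℂ) (((1 / 2 : ℝ) : ℂ) + y * I) := by
    simp only [map_add, map_mul, conj_ofReal, conj_I]
    push_cast
    ring
  rw [hc, Complex.Gamma_conj, Complex.mul_conj, sin_pi_mul_half_add, ← ofReal_div] at h
  rw [Complex.sq_norm]
  exact_mod_cast h

/-- Of the k + 2 factors of the functional equation, the first two supply the growth in `y` and the
rest supply k!. -/
theorem norm_Gamma_half_add_nat_ge (k : ℕ) (y : ℝ) :
    ‖Gamma (((1 / 2 : ℝ) : ℂ) + y * I)‖ * ((1 + y ^ 2) / 4) * k.factorial ≤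
      ‖Gamma (((k + 2 + 1 / 2 : ℝ) : ℂ) + y * I)‖ := by
  have hstep : ∀ x : ℝ, 0 < x → ‖Gamma (((x + 1 : ℝ) : ℂ) + y * I)‖ =
      ‖(x : ℂ) + y * I‖ * ‖Gamma ((x : ℂ) + y * I)‖ := by
    intro x hx
    have hne : (x : ℂ) + y * I ≠ 0 := by
      intro h0
      have := congrArg Complex.re h0
      simp at this
      linarith
    rw [← norm_mul, ← Complex.Gamma_add_one _ hne]
    congr 2
    push_cast; ring
  have hre : ∀ x : ℝ, x ≤ ‖(x : ℂ) + y * I‖ := fun x => by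
    simpa using Complex.re_le_norm ((x : ℂ) + y * I)
  induction k with
  | zero =>
    have e1 := hstep (1 / 2) (by norm_num)
    have e2 := hstep (3 / 2) (by norm_num)
    norm_num at e1 e2 ⊢
    rw [e2, e1]
    have h1 : 1 / 4 + y ^ 2 ≤ ‖(3 / 2 : ℂ) + y * I‖ * ‖(1 / 2 : ℂ) + y * I‖ := by
      have n1 : ‖(1 / 2 : ℂ) + y * I‖ ^ 2 = 1 / 4 + y ^ 2 := by
        have := Complex.normSq_add_mul_I (1 / 2) y
        rw [Complex.sq_norm]
        push_cast at this
        rw [this]; norm_num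
      have n2 : ‖(3 / 2 : ℂ) + y * I‖ ^ 2 = 9 / 4 + y ^ 2 := by
        have := Complex.normSq_add_mul_I (3 / 2) y
        rw [Complex.sq_norm]
        push_cast at this
        rw [this]; norm_num
      have h3 : ‖(1 / 2 : ℂ) + y * I‖ ≤ ‖(3 / 2 : ℂ) + y * I‖ :=
        (sq_le_sq₀ (norm_nonneg _) (norm_nonneg _)).1 (by rw [n1, n2]; linarith)
      nlinarith [norm_nonneg ((1 / 2 : ℂ) + y * I)]
    have h2 : (1 + y ^ 2) / 4 ≤ ‖(3 / 2 : ℂ) + y * I‖ * ‖(1 / 2 : ℂ) + y * I‖ := by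
      nlinarith [sq_nonneg y]
    norm_num at h2
    calc _ ≤ ‖Gamma ((1 / 2 : ℂ) + y * I)‖ *
        (‖(3 / 2 : ℂ) + y * I‖ * ‖(1 / 2 : ℂ) + y * I‖) :=
          mul_le_mul_of_nonneg_left (by simpa using h2) (norm_nonneg _)
      _ = _ := by ring
  | succ k ih =>
    have e := hstep (k + 2 + 1 / 2) (by positivity)
    have : ((((k + 1 : ℕ) : ℝ) + 2 + 1 / 2 : ℝ)) = (k + 2 + 1 / 2 : ℝ) + 1 := by
      push_cast; ring
    rw [this, e, Nat.factorial_succ]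
    have hk := hre (k + 2 + 1 / 2)
    have hk1 : ((k + 1 : ℕ) : ℝ) ≤ ‖((k + 2 + 1 / 2 : ℝ) : ℂ) + y * I‖ := by
      refine le_trans ?_ hk
      push_cast; linarith
    calc _ = ((k + 1 : ℕ) : ℝ) * (‖Gamma (((1 / 2 : ℝ) : ℂ) + y * I)‖ * ((1 + y ^ 2) / 4) *
        k.factorial) := by push_cast; ring
      _ ≤ _ := mul_le_mul hk1 ih (by positivity) (norm_nonneg _)

/-! ### Growth of the Bessel functions in the order. -/

/-- The `n`-th term of the series for `J_ν`. -/
def besselTerm (ν w : ℂ) (n : ℕ) : ℂ :=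
  (-1 : ℂ) ^ n * exp ((ν + 2 * n) * (w - Real.log 2)) /
    ((n.factorial : ℂ) * Gamma (ν + n + 1))

/-- The logarithm of `|z/2|²` at `z = exp w`. -/
def logSq (w : ℂ) : ℝ := 2 * (w.re - Real.log 2)

theorem logSq_conj (w : ℂ) : logSq ((starRingEnd ℂ) w) = logSq w := by simp [logSq]

theorem norm_besselTerm (ν w : ℂ) (n : ℕ) : ‖besselTerm ν w n‖ =
    Real.exp (ν * (w - Real.log 2)).re * (Real.exp (logSq w) ^ n / n.factorial) *
      ‖(Gamma (ν + n + 1))⁻¹‖ := by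
  have h : (((ν + 2 * n) * (w - Real.log 2)) : ℂ).re =
      (ν * (w - Real.log 2)).re + n * logSq w := by
    rw [add_mul, add_re]
    have : (2 * n * (w - Real.log 2) : ℂ) = ((2 * n : ℝ) : ℂ) * (w - Real.log 2) := by
      push_cast; ring
    rw [this, re_ofReal_mul, logSq, sub_re, ofReal_re]
    ring
  rw [besselTerm, norm_div, norm_mul, norm_pow, norm_neg, norm_one, one_pow, one_mul, norm_mul,
    Complex.norm_natCast, Complex.norm_exp, h, Real.exp_add, norm_inv, Real.exp_nat_mul]
  field_simp

theorem summable_exp_pow_div (q : ℝ) : Summable fun n : ℕ => q ^ n / (n.factorial : ℝ) :=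
  Real.summable_pow_div_factorial q

theorem tsum_exp_pow_div (q : ℝ) : ∑' n : ℕ, q ^ n / (n.factorial : ℝ) = Real.exp q := by
  rw [Real.exp_eq_exp_ℝ, NormedSpace.exp_eq_tsum_div]

theorem norm_besselTerm_le {ν w : ℂ} {C : ℝ} (hC : ∀ n : ℕ, ‖(Gamma (ν + n + 1))⁻¹‖ ≤ C) (n : ℕ) :
    ‖besselTerm ν w n‖ ≤ Real.exp (ν * (w - Real.log 2)).re * C *
      (Real.exp (logSq w) ^ n / n.factorial) := by
  rw [norm_besselTerm, mul_right_comm]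
  exact mul_le_mul_of_nonneg_right (mul_le_mul_of_nonneg_left (hC n) (Real.exp_pos _).le)
    (by positivity)

theorem norm_besselJLog_le {ν w : ℂ} {C : ℝ} (hC : ∀ n : ℕ, ‖(Gamma (ν + n + 1))⁻¹‖ ≤ C) :
    ‖besselJLog ν w‖ ≤ Real.exp (ν * (w - Real.log 2)).re * C * Real.exp (Real.exp (logSq w)) := by
  have hs := (summable_exp_pow_div (Real.exp (logSq w))).mul_left
    (Real.exp (ν * (w - Real.log 2)).re * C)
  refine (tsum_of_norm_bounded hs.hasSum (norm_besselTerm_le hC)).trans (le_of_eq ?_)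
  rw [tsum_mul_left, tsum_exp_pow_div]

theorem norm_inv_Gamma_shift_le {B : ℕ} {ν : ℂ} (h : -(B : ℝ) ≤ ν.re) (n : ℕ) :
    ‖(Gamma (ν + n + 1))⁻¹‖ ≤ 4 * (B + 1).factorial * Real.exp (Real.pi * |ν.im|) := by
  have := norm_inv_Gamma_le (B := B) (s := ν + n + 1) (by
    have : (0 : ℝ) ≤ n := Nat.cast_nonneg n
    simp; linarith)
  simpa using this

theorem norm_besselJLog_le_of_re {B : ℕ} {ν w : ℂ} (h : -(B : ℝ) ≤ ν.re) :
    ‖besselJLog ν w‖ ≤ Real.exp (ν * (w - Real.log 2)).re *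
      (4 * (B + 1).factorial * Real.exp (Real.pi * |ν.im|)) * Real.exp (Real.exp (logSq w)) :=
  norm_besselJLog_le (norm_inv_Gamma_shift_le h)

theorem summable_besselTerm (ν w : ℂ) : Summable (besselTerm ν w) := by
  obtain ⟨B, hB⟩ := exists_nat_ge (-ν.re)
  exact Summable.of_norm_bounded (((summable_exp_pow_div (Real.exp (logSq w))).mul_left _))
    (norm_besselTerm_le (norm_inv_Gamma_shift_le (B := B) (by linarith)))

theorem hasSum_besselTerm (ν w : ℂ) : HasSum (besselTerm ν w) (besselJLog ν w) :=
  (summable_besselTerm ν w).hasSum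

theorem differentiable_besselTerm (w : ℂ) (n : ℕ) :
    Differentiable ℂ fun ν => besselTerm ν w n := by
  have h : (fun ν => besselTerm ν w n) = fun ν => (-1 : ℂ) ^ n *
      exp ((ν + 2 * n) * (w - Real.log 2)) * ((n.factorial : ℂ)⁻¹ * (Gamma (ν + n + 1))⁻¹) := by
    funext ν
    rw [besselTerm, div_eq_mul_inv, mul_inv]
  have hG : Differentiable ℂ fun ν : ℂ => (Gamma (ν + n + 1))⁻¹ :=
    Complex.differentiable_one_div_Gamma.comp (by fun_prop : Differentiable ℂ fun ν : ℂ => ν + n + 1)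
  rw [h]
  fun_prop

/-- Weierstrass test on unit discs: the bounds on 1/Γ are uniform in the index `n`. -/
theorem differentiable_besselJLog (w : ℂ) : Differentiable ℂ fun ν => besselJLog ν w := by
  intro ν₀
  obtain ⟨B, hB⟩ := exists_nat_ge (‖ν₀‖ + 1)
  have hball : ∀ ν ∈ Metric.ball ν₀ 1, ‖ν‖ ≤ B := by
    intro ν hν
    rw [Metric.mem_ball, dist_eq_norm] at hν
    have := norm_le_norm_add_norm_sub' ν ν₀
    linarith
  refine (differentiableOn_tsum_of_summable_norm (F := fun n ν => besselTerm ν w n)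
    (U := Metric.ball ν₀ 1) ((summable_exp_pow_div (Real.exp (logSq w))).mul_left
      (Real.exp (B * ‖w - Real.log 2‖) * (4 * (B + 1).factorial * Real.exp (Real.pi * B))))
    (fun n => (differentiable_besselTerm w n).differentiableOn) Metric.isOpen_ball
    fun n ν hν => ?_).differentiableAt (Metric.ball_mem_nhds _ one_pos)
  have hn := hball ν hν
  have hre : -(B : ℝ) ≤ ν.re := by
    have := (abs_le.1 ((Complex.abs_re_le_norm ν).trans hn)).1
    linarith
  refine (norm_besselTerm_le (norm_inv_Gamma_shift_le hre) n).trans ?_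
  refine mul_le_mul_of_nonneg_right ?_ (by positivity)
  refine mul_le_mul (Real.exp_le_exp.2 ?_) ?_ (by positivity) (Real.exp_pos _).le
  · refine (Complex.re_le_norm _).trans ?_
    rw [norm_mul]
    exact mul_le_mul_of_nonneg_right hn (norm_nonneg _)
  · refine mul_le_mul_of_nonneg_left (Real.exp_le_exp.2 ?_) (by positivity)
    exact mul_le_mul_of_nonneg_left ((Complex.abs_im_le_norm ν).trans hn) Real.pi_pos.le

/-- Since |Γ(1/2 + iy)|² = π / cosh(πy), one Bessel function costs the square root of cosh(πy), and
two of them cost exactly the cosh(πy) that the sine cancels. -/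
theorem norm_inv_Gamma_half_line_le (k n : ℕ) (y : ℝ) :
    ‖(Gamma ((((k + 1 + 1 / 2 : ℝ) : ℂ) + y * I) + n + 1))⁻¹‖ ≤
      Real.sqrt (Real.cosh (Real.pi * y)) * (4 / ((1 + y ^ 2) * k.factorial)) := by
  have h := norm_Gamma_half_add_nat_ge (k + n) y
  have e : ((((k + 1 + 1 / 2 : ℝ) : ℂ) + y * I) + n + 1) =
      ((((k + n : ℕ) : ℝ) + 2 + 1 / 2 : ℝ) : ℂ) + y * I := by push_cast; ring
  rw [e, norm_inv]
  have hc := Real.cosh_pos (Real.pi * y)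
  have hG : (Real.sqrt (Real.cosh (Real.pi * y)))⁻¹ ≤
      ‖Gamma (((1 / 2 : ℝ) : ℂ) + y * I)‖ := by
    rw [← Real.sqrt_inv]
    refine Real.sqrt_le_iff.2 ⟨norm_nonneg _, ?_⟩
    rw [norm_Gamma_half_sq, inv_eq_one_div]
    gcongr
    linarith [Real.pi_gt_three]
  have hfac : (k.factorial : ℝ) ≤ (k + n).factorial := by
    exact_mod_cast Nat.factorial_le (Nat.le_add_right k n)
  have hs := Real.sqrt_pos.2 hc
  have hk : (0 : ℝ) < k.factorial := by exact_mod_cast Nat.factorial_pos k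
  have hlow : (Real.sqrt (Real.cosh (Real.pi * y)))⁻¹ * ((1 + y ^ 2) / 4) * k.factorial ≤
      ‖Gamma ((((k + n : ℕ) : ℝ) + 2 + 1 / 2 : ℝ) + y * I)‖ := by
    refine le_trans ?_ h
    gcongr
  refine (inv_anti₀ (by positivity) hlow).trans (le_of_eq ?_)
  field_simp

theorem norm_besselJLog_half_line_le (k : ℕ) (y : ℝ) (w : ℂ) :
    ‖besselJLog (((k + 1 + 1 / 2 : ℝ) : ℂ) + y * I) w‖ ≤
      Real.exp ((((k + 1 + 1 / 2 : ℝ) : ℂ) + y * I) * (w - Real.log 2)).re *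
      (Real.sqrt (Real.cosh (Real.pi * y)) * (4 / ((1 + y ^ 2) * k.factorial))) *
      Real.exp (Real.exp (logSq w)) :=
  norm_besselJLog_le fun n => norm_inv_Gamma_half_line_le k n y

/-- Conjugate logarithms cancel both the shift by `p` and the contribution of Im s. -/
theorem exp_re_mul_exp_re (s w : ℂ) (p : ℤ) :
    Real.exp ((s + p) * (w - Real.log 2)).re *
      Real.exp ((s - p) * ((starRingEnd ℂ) w - Real.log 2)).re = Real.exp (s.re * logSq w) := by
  rw [← Real.exp_add]
  congr 1
  simp only [logSq, add_re, mul_re, sub_re, sub_im, add_im, conj_re, conj_im, intCast_re,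
    intCast_im, ofReal_re, ofReal_im]
  ring

/-- A crude bound valid on every strip. Its growth in Im s exceeds that of the sine, so it is useful
only against a Gaussian. -/
theorem norm_besselJProd_le (z s : ℂ) (p : ℤ) {R : ℕ} (hs : |s.re| ≤ R) :
    ‖besselJProd s p z‖ ≤ Real.exp (R * |logSq (log z)|) *
      Real.exp (2 * Real.exp (logSq (log z))) *
      (16 * ((p.natAbs + R + 1).factorial : ℝ) ^ 2) * Real.exp (2 * Real.pi * |s.im|) := by
  set w := log z
  have hp : |(p : ℝ)| = p.natAbs := by rw [← Int.cast_abs, Nat.cast_natAbs]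
  have hp1 := abs_le.1 hp.le
  have hs1 := abs_le.1 hs
  have h1 := norm_besselJLog_le_of_re (B := p.natAbs + R) (ν := s + p) (w := w)
    (by push_cast; simp; linarith)
  have h2 := norm_besselJLog_le_of_re (B := p.natAbs + R) (ν := s - p) (w := (starRingEnd ℂ) w)
    (by push_cast; simp; linarith)
  have i1 : (s + p).im = s.im := by simp
  have i2 : (s - p).im = s.im := by simp
  rw [i1] at h1
  rw [i2, logSq_conj] at h2
  rw [besselJProd, norm_mul]
  refine (mul_le_mul h1 h2 (norm_nonneg _) (by positivity)).trans ?_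
  have e1 := exp_re_mul_exp_re s w p
  have e2 : Real.exp (2 * Real.exp (logSq w)) =
      Real.exp (Real.exp (logSq w)) * Real.exp (Real.exp (logSq w)) := by
    rw [← Real.exp_add]; ring_nf
  have e3 : Real.exp (2 * Real.pi * |s.im|) =
      Real.exp (Real.pi * |s.im|) * Real.exp (Real.pi * |s.im|) := by
    rw [← Real.exp_add]; ring_nf
  have e4 : Real.exp (s.re * logSq w) ≤ Real.exp (R * |logSq w|) := by
    refine Real.exp_le_exp.2 ((le_abs_self _).trans ?_)
    rw [abs_mul]
    exact mul_le_mul_of_nonneg_right hs (abs_nonneg _)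
  rw [← e1] at e4
  rw [e2, e3]
  have := mul_le_mul_of_nonneg_right e4 (by positivity :
    0 ≤ Real.exp (Real.exp (logSq w)) * Real.exp (Real.exp (logSq w)) *
      (16 * ((p.natAbs + R + 1).factorial : ℝ) ^ 2) *
      (Real.exp (Real.pi * |s.im|) * Real.exp (Real.pi * |s.im|)))
  refine le_trans (le_of_eq ?_) (this.trans (le_of_eq ?_)) <;> ring

theorem differentiable_besselJProd (p : ℤ) (z : ℂ) :
    Differentiable ℂ fun s => besselJProd s p z := by
  have h1 := (differentiable_besselJLog (log z)).comp
    (by fun_prop : Differentiable ℂ fun s : ℂ => s + p)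
  have h2 := (differentiable_besselJLog ((starRingEnd ℂ) (log z))).comp
    (by fun_prop : Differentiable ℂ fun s : ℂ => s - p)
  exact h1.mul h2

/-- `(p² - s²) J_{s,p}(z)`. -/
def besselPsi (z : ℂ) (p : ℤ) (s : ℂ) : ℂ := ((p : ℂ) ^ 2 - s ^ 2) * besselJProd s p z

theorem norm_sq_sub_sq_le (p : ℤ) (s : ℂ) :
    ‖(p : ℂ) ^ 2 - s ^ 2‖ ≤ (p : ℝ) ^ 2 + s.re ^ 2 + s.im ^ 2 := by
  refine (norm_sub_le _ _).trans ?_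
  rw [norm_pow, norm_pow, Complex.norm_intCast, sq_abs, Complex.sq_norm, Complex.normSq_apply]
  nlinarith

theorem stripGrowth_besselPsi (z : ℂ) (p : ℤ) : StripGrowth (besselPsi z p) := by
  intro R'
  obtain ⟨R, hR⟩ := exists_nat_ge R'
  set D := Real.exp (R * |logSq (log z)|) * Real.exp (2 * Real.exp (logSq (log z))) *
      (16 * ((p.natAbs + R + 1).factorial : ℝ) ^ 2)
  refine ⟨((p : ℝ) ^ 2 + R ^ 2 + 2) * D, 1 + 2 * Real.pi, fun s hs => ?_⟩
  have hs' := hs.trans hR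
  have h1 := norm_besselJProd_le z s p hs'
  have h2 := norm_sq_sub_sq_le p s
  have h3 : (p : ℝ) ^ 2 + s.re ^ 2 + s.im ^ 2 ≤ ((p : ℝ) ^ 2 + R ^ 2 + 2) * Real.exp |s.im| := by
    have e := Real.quadratic_le_exp_of_nonneg (abs_nonneg s.im)
    have e2 : s.re ^ 2 ≤ (R : ℝ) ^ 2 := by
      rw [← sq_abs]; exact pow_le_pow_left₀ (abs_nonneg _) hs' 2
    have e3 : 1 ≤ Real.exp |s.im| := Real.one_le_exp (abs_nonneg _)
    rw [sq_abs] at e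
    nlinarith [abs_nonneg s.im, mul_nonneg (by positivity : 0 ≤ (p : ℝ) ^ 2 + (R : ℝ) ^ 2)
      (sub_nonneg.2 e3)]
  rw [besselPsi, norm_mul]
  calc _ ≤ ((p : ℝ) ^ 2 + R ^ 2 + 2) * Real.exp |s.im| * (D * Real.exp (2 * Real.pi * |s.im|)) :=
        mul_le_mul (h2.trans h3) h1 (norm_nonneg _) (by positivity)
    _ = _ := by rw [add_mul 1, Real.exp_add, one_mul]; ring

/-- On these lines both s + p and s - p have real part at least 3/2. The two Bessel factors bring (1
+ y²)⁻², of which one power pays for p² - s² and the other is the decay required by `LineBound`. One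
factorial 1/m! is enough to beat all exponentials in `m`. -/
theorem lineBound_besselPsi (z : ℂ) (p : ℤ) (m : ℕ) :
    LineBound (besselPsi z p) (((p.natAbs + 1 + m : ℕ) : ℝ) + 1 / 2)
      (64 * ((p : ℝ) ^ 2 + 3) * Real.exp (2 * Real.exp (logSq (log z))) *
        Real.exp ((logSq (log z) + 1) * (((p.natAbs + 1 + m : ℕ) : ℝ) + 1 / 2)) /
        m.factorial) := by
  intro y
  set w := log z
  set x : ℝ := ((p.natAbs + 1 + m : ℕ) : ℝ) + 1 / 2 with hx
  have hpa : (0 : ℤ) ≤ p.natAbs + p := by omega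
  have hpb : (0 : ℤ) ≤ p.natAbs - p := by omega
  obtain ⟨a, ha⟩ := Int.eq_ofNat_of_zero_le hpa
  obtain ⟨b, hb⟩ := Int.eq_ofNat_of_zero_le hpb
  have ha' : (p.natAbs : ℝ) + p = a := by
    have := congrArg (fun n : ℤ => (n : ℝ)) ha
    simpa only [Int.cast_add, Int.cast_natCast] using this
  have hb' : (p.natAbs : ℝ) - p = b := by
    have := congrArg (fun n : ℤ => (n : ℝ)) hb
    simpa only [Int.cast_sub, Int.cast_natCast] using this
  have h1 := norm_besselJLog_half_line_le (a + m) y w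
  have h2 := norm_besselJLog_half_line_le (b + m) y ((starRingEnd ℂ) w)
  have e1 : ((((a + m : ℕ) : ℝ) + 1 + 1 / 2 : ℝ) : ℂ) + y * I = (x : ℂ) + y * I + p := by
    have : (((a + m : ℕ) : ℝ) + 1 + 1 / 2 : ℝ) = x + p := by
      rw [hx]; push_cast; rw [← ha']; ring
    rw [this]; push_cast; ring
  have e2 : ((((b + m : ℕ) : ℝ) + 1 + 1 / 2 : ℝ) : ℂ) + y * I = (x : ℂ) + y * I - p := by
    have : (((b + m : ℕ) : ℝ) + 1 + 1 / 2 : ℝ) = x - p := by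
      rw [hx]; push_cast; rw [← hb']; ring
    rw [this]; push_cast; ring
  rw [e1] at h1
  rw [e2, logSq_conj] at h2
  set s : ℂ := (x : ℂ) + y * I with hs
  have hsre : s.re = x := by simp [hs]
  have hsim : s.im = y := by simp [hs]
  have hc := Real.cosh_pos (Real.pi * y)
  have hsq : Real.sqrt (Real.cosh (Real.pi * y)) * Real.sqrt (Real.cosh (Real.pi * y)) =
      Real.cosh (Real.pi * y) := Real.mul_self_sqrt hc.le
  have hm : (1 : ℝ) ≤ m.factorial := by exact_mod_cast Nat.factorial_pos m
  have hfa : (m.factorial : ℝ) ≤ (a + m).factorial := by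
    exact_mod_cast Nat.factorial_le (Nat.le_add_left m a)
  have hfb : (1 : ℝ) ≤ (b + m).factorial := by exact_mod_cast Nat.factorial_pos _
  have hy : 0 < 1 + y ^ 2 := by positivity
  have k1 : (4 : ℝ) / ((1 + y ^ 2) * (a + m).factorial) ≤ 4 / ((1 + y ^ 2) * m.factorial) := by
    gcongr
  have k2 : (4 : ℝ) / ((1 + y ^ 2) * (b + m).factorial) ≤ 4 / (1 + y ^ 2) := by
    gcongr
    nlinarith
  have hprod : ‖besselJProd s p z‖ ≤ Real.exp (x * logSq w) *
      Real.exp (2 * Real.exp (logSq w)) *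
      (Real.sqrt (Real.cosh (Real.pi * y)) * Real.sqrt (Real.cosh (Real.pi * y))) *
      (4 / ((1 + y ^ 2) * m.factorial) * (4 / (1 + y ^ 2))) := by
    rw [besselJProd, norm_mul]
    refine (mul_le_mul h1 h2 (norm_nonneg _) (by positivity)).trans ?_
    have e4 : Real.exp (2 * Real.exp (logSq w)) =
        Real.exp (Real.exp (logSq w)) * Real.exp (Real.exp (logSq w)) := by
      rw [← Real.exp_add]; ring_nf
    rw [← hsre, ← exp_re_mul_exp_re s w p, e4]
    have := mul_le_mul k1 k2 (by positivity) (by positivity)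
    refine le_trans (le_of_eq ?_) (mul_le_mul_of_nonneg_left this (by positivity :
      0 ≤ Real.exp ((s + p) * (w - Real.log 2)).re *
      Real.exp ((s - p) * ((starRingEnd ℂ) w - Real.log 2)).re *
      (Real.exp (Real.exp (logSq w)) * Real.exp (Real.exp (logSq w))) *
      (Real.sqrt (Real.cosh (Real.pi * y)) * Real.sqrt (Real.cosh (Real.pi * y)))))
    ring
  have hpoly : ‖(p : ℂ) ^ 2 - s ^ 2‖ ≤ 4 * (((p : ℝ) ^ 2 + 3) * Real.exp x) * (1 + y ^ 2) := by
    refine (norm_sq_sub_sq_le p s).trans ?_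
    rw [hsre, hsim]
    have hx0 : 0 ≤ x := by positivity
    have e := Real.quadratic_le_exp_of_nonneg hx0
    have e3 : 1 ≤ Real.exp x := Real.one_le_exp hx0
    have e5 : (p : ℝ) ^ 2 + x ^ 2 + 1 ≤ ((p : ℝ) ^ 2 + 3) * Real.exp x := by
      nlinarith [mul_nonneg (sq_nonneg (p : ℝ)) (sub_nonneg.2 e3)]
    have e6 : (p : ℝ) ^ 2 + x ^ 2 + y ^ 2 ≤ ((p : ℝ) ^ 2 + x ^ 2 + 1) * (1 + y ^ 2) := by
      nlinarith [mul_nonneg (by positivity : 0 ≤ (p : ℝ) ^ 2 + x ^ 2) (sq_nonneg y)]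
    have := mul_le_mul_of_nonneg_right e5 hy.le
    nlinarith [mul_nonneg (by positivity : 0 ≤ ((p : ℝ) ^ 2 + 3) * Real.exp x) hy.le]
  rw [hsq] at hprod
  rw [besselPsi, norm_mul]
  refine (mul_le_mul hpoly hprod (norm_nonneg _) (by positivity)).trans (le_of_eq ?_)
  have e7 : Real.exp ((logSq w + 1) * x) = Real.exp (x * logSq w) * Real.exp x := by
    rw [← Real.exp_add]; ring_nf
  rw [e7]
  field_simp
  ring

theorem mellinClass_besselPsi (z : ℂ) (p : ℤ) : MellinClass (besselPsi z p) where
  differentiable := by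
    have := differentiable_besselJProd p z
    unfold besselPsi
    fun_prop
  growth := stripGrowth_besselPsi z p
  lines := by
    refine ⟨p.natAbs + 1, _, lineBound_besselPsi z p, fun x => ?_⟩
    set L := logSq (log z)
    have h := (FloorSemiring.tendsto_pow_div_factorial_atTop (Real.exp (L + 1 + x))).const_mul
      (64 * ((p : ℝ) ^ 2 + 3) * Real.exp (2 * Real.exp L) *
        Real.exp ((L + 1) * ((p.natAbs : ℝ) + 1 + 1 / 2)))
    rw [mul_zero] at h
    refine h.congr fun m => ?_
    have e : Real.exp ((L + 1) * (((p.natAbs + 1 + m : ℕ) : ℝ) + 1 / 2)) * Real.exp (x * m) =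
        Real.exp ((L + 1) * ((p.natAbs : ℝ) + 1 + 1 / 2)) * Real.exp (L + 1 + x) ^ m := by
      rw [← Real.exp_nat_mul, ← Real.exp_add, ← Real.exp_add]
      push_cast
      ring_nf
    rw [div_mul_eq_mul_div, mul_assoc _ _ (Real.exp (x * m)), e]
    ring

/-! ### Symmetry at integer orders. -/

/-- The first `m` terms vanish: `Gamma` is 0 at its poles and division by 0 gives 0, which agrees
with the true value of 1/Γ. The remaining terms are those of J_m up to sign. -/
theorem besselJLog_neg_nat (m : ℕ) (w : ℂ) :
    besselJLog (-(m : ℂ)) w = (-1) ^ m * besselJLog m w := by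
  have h0 : ∀ n ∈ Finset.range m, besselTerm (-(m : ℂ)) w n = 0 := by
    intro n hn
    have hn := Finset.mem_range.1 hn
    have : (-(m : ℂ) + n + 1) = -((m - n - 1 : ℕ) : ℂ) := by
      rw [Nat.cast_sub (by omega), Nat.cast_sub (by omega)]
      push_cast; ring
    rw [besselTerm, this, Complex.Gamma_neg_nat_eq_zero, mul_zero, div_zero]
  have h1 := (hasSum_nat_add_iff' m).2 (hasSum_besselTerm (-(m : ℂ)) w)
  rw [Finset.sum_eq_zero h0, sub_zero] at h1
  refine h1.unique ?_
  have h2 : ∀ n : ℕ, besselTerm (-(m : ℂ)) w (n + m) = (-1) ^ m * besselTerm m w n := by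
    intro n
    have e1 : (-(m : ℂ) + ((n + m : ℕ) : ℂ) + 1) = (n : ℂ) + 1 := by push_cast; ring
    have e2 : ((m : ℂ) + n + 1) = ((n + m : ℕ) : ℂ) + 1 := by push_cast; ring
    have e3 : (-(m : ℂ) + 2 * ((n + m : ℕ) : ℂ)) = m + 2 * n := by push_cast; ring
    rw [besselTerm, besselTerm, e1, e2, e3, Complex.Gamma_nat_eq_factorial,
      Complex.Gamma_nat_eq_factorial, pow_add]
    ring
  simp only [h2]
  exact (hasSum_besselTerm m w).mul_left _

theorem besselJLog_neg_int (m : ℤ) (w : ℂ) :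
    besselJLog (-(m : ℂ)) w = (-1) ^ m * besselJLog m w := by
  obtain ⟨k, rfl | rfl⟩ := Int.eq_nat_or_neg m
  · simpa using besselJLog_neg_nat k w
  · have h := besselJLog_neg_nat k w
    have h1 : ((-1 : ℂ) ^ k) * (-1) ^ k = 1 := by rw [← mul_pow]; simp
    rw [zpow_neg, zpow_natCast, ← inv_pow, inv_neg, inv_one]
    push_cast
    rw [neg_neg, h, ← mul_assoc, h1, one_mul]

theorem besselJProd_neg_int (n p : ℤ) (z : ℂ) :
    besselJProd (-(n : ℂ)) p z = besselJProd n (-p) z := by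
  have e1 : (-(n : ℂ) + p) = -((n - p : ℤ) : ℂ) := by push_cast; ring
  have e2 : (-(n : ℂ) - p) = -((n + p : ℤ) : ℂ) := by push_cast; ring
  have e3 : ((n : ℂ) + ((-p : ℤ) : ℂ)) = ((n - p : ℤ) : ℂ) := by push_cast; ring
  have e4 : ((n : ℂ) - ((-p : ℤ) : ℂ)) = ((n + p : ℤ) : ℂ) := by push_cast; ring
  have h : ((-1 : ℂ) ^ (n - p)) * (-1) ^ (n + p) = 1 := by
    rw [← zpow_add₀ (by norm_num), show n - p + (n + p) = 2 * n by ring, zpow_mul]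
    simp
  rw [besselJProd, besselJProd, e1, e2, e3, e4, besselJLog_neg_int, besselJLog_neg_int]
  linear_combination (besselJLog ((n - p : ℤ) : ℂ) (log z) *
    besselJLog ((n + p : ℤ) : ℂ) ((starRingEnd ℂ) (log z))) * h

theorem besselPsi_neg_int (z : ℂ) (p n : ℤ) : besselPsi z p (-n) = besselPsi z (-p) n := by
  rw [besselPsi, besselPsi, besselJProd_neg_int]
  push_cast
  ring

/-! ### The generating function of the Bessel functions. -/

theorem hasSum_of_eq {ι : Type*} {f g : ι → ℂ} {a b : ℂ} (h : HasSum f a) (hfg : ∀ i, g i = f i)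
    (hab : b = a) : HasSum g b := by
  rw [hab, funext hfg]
  exact h

theorem hasSum_mul_complex {ι κ : Type*} {f : ι → ℂ} {g : κ → ℂ} {a b : ℂ} (hf : HasSum f a)
    (hg : HasSum g b) : HasSum (fun q : ι × κ => f q.1 * g q.2) (a * b) :=
  hf.mul hg (summable_mul_of_summable_norm hf.summable.norm hg.summable.norm)

theorem hasSum_nat_mul_pow_div_factorial (x : ℂ) :
    HasSum (fun a : ℕ => (a : ℂ) * (x ^ a / a.factorial)) (x * exp x) := by
  have h : HasSum (fun a : ℕ => x ^ a / (a.factorial : ℂ)) (exp x) := by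
    rw [Complex.exp_eq_exp_ℂ]; exact NormedSpace.expSeries_div_hasSum_exp x
  have h1 : HasSum (fun a : ℕ => ((a + 1 : ℕ) : ℂ) * (x ^ (a + 1) / (a + 1).factorial))
      (x * exp x) := by
    refine hasSum_of_eq (h.mul_left x) (fun a => ?_) rfl
    have h1 : ((a + 1 : ℕ) : ℂ) ≠ 0 := Nat.cast_ne_zero.2 (Nat.succ_ne_zero a)
    have h2 : (a.factorial : ℂ) ≠ 0 := Nat.cast_ne_zero.2 (Nat.factorial_ne_zero a)
    rw [Nat.factorial_succ, Nat.cast_mul, pow_succ]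
    field_simp
  have h2 := (hasSum_nat_add_iff (f := fun a : ℕ => (a : ℂ) * (x ^ a / a.factorial)) 1).1 h1
  simpa using h2

/-- This is x∂_x - y∂_y applied to e^x e^y. With x = (z/2)t and y = -(z/2)/t it becomes the operator
t d/dt. -/
theorem hasSum_sub_mul_pow_mul_pow (x y : ℂ) :
    HasSum (fun q : ℕ × ℕ => ((q.1 : ℂ) - q.2) * (x ^ q.1 / q.1.factorial) *
      (y ^ q.2 / q.2.factorial)) ((x - y) * exp (x + y)) := by
  have h : ∀ x : ℂ, HasSum (fun a : ℕ => x ^ a / (a.factorial : ℂ)) (exp x) := fun x => by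
    rw [Complex.exp_eq_exp_ℂ]; exact NormedSpace.expSeries_div_hasSum_exp x
  have h1 := hasSum_mul_complex (hasSum_nat_mul_pow_div_factorial x) (h y)
  have h2 := hasSum_mul_complex (h x) (hasSum_nat_mul_pow_div_factorial y)
  refine hasSum_of_eq (h1.sub h2) (fun q => by ring) ?_
  rw [Complex.exp_add]; ring

theorem besselTerm_int_eq_zero {m : ℤ} {b : ℕ} (h : m + b < 0) (w : ℂ) :
    besselTerm m w b = 0 := by
  have : ((m : ℂ) + b + 1) = -(((-(m + b) - 1).toNat : ℕ) : ℂ) := by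
    have h1 : (((-(m + b) - 1).toNat : ℕ) : ℤ) = -(m + b) - 1 := Int.toNat_of_nonneg (by omega)
    have h2 : (((-(m + b) - 1).toNat : ℕ) : ℂ) = ((-(m + b) - 1 : ℤ) : ℂ) := by
      rw [← h1]; simp
    rw [h2]; push_cast; ring
  rw [besselTerm, this, Complex.Gamma_neg_nat_eq_zero, mul_zero, div_zero]

theorem besselTerm_sub (w ζ : ℂ) (a b : ℕ) :
    (((a : ℤ) - b : ℤ) : ℂ) * I ^ ((a : ℤ) - b) * exp ((((a : ℤ) - b : ℤ) : ℂ) * ζ) *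
      besselTerm (((a : ℤ) - b : ℤ) : ℂ) w b =
    ((a : ℂ) - b) * ((I * exp (w - Real.log 2 + ζ)) ^ a / a.factorial) *
      ((I * exp (w - Real.log 2 - ζ)) ^ b / b.factorial) := by
  have e0 : (((a : ℤ) - b : ℤ) : ℂ) = (a : ℂ) - b := by push_cast; ring
  have e1 : ((a : ℂ) - b + b + 1) = (a : ℂ) + 1 := by ring
  have e2 : (I : ℂ) ^ ((a : ℤ) - b) * (-1) ^ b = I ^ a * I ^ b := by
    rw [zpow_sub₀ I_ne_zero, zpow_natCast, zpow_natCast, ← Complex.I_sq, ← pow_mul, mul_comm 2 b,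
      pow_mul, sq]
    field_simp [I_ne_zero]
  have e3 : exp (((a : ℂ) - b) * ζ) * exp (((a : ℂ) - b + 2 * b) * (w - Real.log 2)) =
      exp (w - Real.log 2 + ζ) ^ a * exp (w - Real.log 2 - ζ) ^ b := by
    rw [← Complex.exp_nat_mul, ← Complex.exp_nat_mul, ← Complex.exp_add, ← Complex.exp_add]
    congr 1; ring
  rw [e0, besselTerm, e1, Complex.Gamma_nat_eq_factorial, mul_pow, mul_pow]
  calc _ = ((a : ℂ) - b) * (I ^ ((a : ℤ) - b) * (-1) ^ b) *
      (exp (((a : ℂ) - b) * ζ) * exp (((a : ℂ) - b + 2 * b) * (w - Real.log 2))) /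
        ((b.factorial : ℂ) * a.factorial) := by ring
    _ = _ := by rw [e2, e3]; ring

/-- The logarithmic derivative with respect to `t` of the generating function
`exp((z/2)(t - 1/t)) = ∑ J_m(z) t^m`, at `t = i exp ζ`. -/
theorem hasSum_int_mul_besselJLog (w ζ : ℂ) :
    HasSum (fun m : ℤ => (m : ℂ) * I ^ m * exp (m * ζ) * besselJLog m w)
      (I * exp w * sinh ζ * exp (I * (exp w * cosh ζ))) := by
  have h := hasSum_sub_mul_pow_mul_pow (I * exp (w - Real.log 2 + ζ))
    (I * exp (w - Real.log 2 - ζ))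
  -- Pairs (a, b) of exponents are regrouped by the order m = a - b. Pairs (m, b) outside the image
  -- have m + b < 0, where the Bessel term is zero.
  have hinj : Function.Injective fun q : ℕ × ℕ => (((q.1 : ℤ) - q.2, q.2) : ℤ × ℕ) := by
    rintro ⟨a, b⟩ ⟨c, d⟩ h
    simp only [Prod.mk.injEq] at h ⊢
    omega
  have hsum : HasSum (fun q : ℤ × ℕ => (q.1 : ℂ) * I ^ q.1 * exp (q.1 * ζ) *
      besselTerm q.1 w q.2) ((I * exp (w - Real.log 2 + ζ) - I * exp (w - Real.log 2 - ζ)) *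
      exp (I * exp (w - Real.log 2 + ζ) + I * exp (w - Real.log 2 - ζ))) := by
    refine (hinj.hasSum_iff ?_).1 (hasSum_of_eq h (fun q => besselTerm_sub w ζ q.1 q.2) rfl)
    rintro ⟨m, b⟩ hq
    refine mul_eq_zero_of_right _ (besselTerm_int_eq_zero ?_ w)
    by_contra hcon
    refine hq ⟨((m + b).toNat, b), ?_⟩
    simp only [Prod.mk.injEq, and_true]
    simp only at hcon
    omega
  have hrow : ∀ m : ℤ, HasSum (fun b : ℕ => (m : ℂ) * I ^ m * exp (m * ζ) * besselTerm m w b)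
      ((m : ℂ) * I ^ m * exp (m * ζ) * besselJLog m w) := fun m =>
    (hasSum_besselTerm m w).mul_left _
  refine hasSum_of_eq (hsum.prod_fiberwise hrow) (fun _ => rfl) ?_
  have hw : exp w = 2 * exp (w - Real.log 2) := by
    rw [Complex.exp_sub, ← ofReal_exp, Real.exp_log two_pos]
    push_cast; field_simp
  rw [hw, Complex.sinh, Complex.cosh, sub_eq_add_neg _ ζ, Complex.exp_add _ ζ,
    Complex.exp_add _ (-ζ)]
  generalize exp (w - Real.log 2) = u
  rw [show I * (2 * u * ((exp ζ + exp (-ζ)) / 2)) = I * (u * exp ζ) + I * (u * exp (-ζ)) by ring]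
  ring

/-! ### Fourier coefficients of the oscillating kernel. -/

theorem re_mul_trh (z : ℂ) (r ω : ℝ) :
    ((2 * (z * trh r ω).re : ℝ) : ℂ) = z * cosh (r + ω * I) +
      (starRingEnd ℂ) z * cosh (r - ω * I) := by
  have h : trh r ω = cosh (r + ω * I) := by
    rw [trh, Complex.cosh_add, Complex.cosh_mul_I, Complex.sinh_mul_I]
    push_cast; ring
  have h2 : (starRingEnd ℂ) (cosh (r + ω * I)) = cosh (r - ω * I) := by
    rw [← Complex.cosh_conj]
    simp [sub_eq_add_neg]
  rw [← h2, ← map_mul, Complex.add_conj, h]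

theorem sinh_mul_sinh (r ω : ℝ) : sinh (r + ω * I) * sinh (r - ω * I) =
    ((Real.sinh r ^ 2 + Real.sin ω ^ 2 : ℝ) : ℂ) := by
  rw [Complex.sinh_add, Complex.sinh_sub, Complex.cosh_mul_I, Complex.sinh_mul_I]
  push_cast
  have h1 := Complex.cosh_sq r
  have h2 := Complex.sin_sq_add_cos_sq ω
  linear_combination (sin (ω : ℂ)) ^ 2 * h1 + (sinh (r : ℂ)) ^ 2 * h2 -
    (cosh (r : ℂ)) ^ 2 * (sin (ω : ℂ)) ^ 2 * Complex.I_sq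

/-- The coefficients of the double Fourier expansion of the oscillating kernel. -/
def pairCoeff (z : ℂ) (r : ℝ) (q : ℤ × ℤ) : ℂ :=
  (q.1 * I ^ q.1 * besselJLog q.1 (log z)) *
    (q.2 * I ^ q.2 * besselJLog q.2 ((starRingEnd ℂ) (log z))) * exp (r * (q.1 + q.2))

theorem hasSum_pairCoeff {z : ℂ} (hz : z ≠ 0) (r ω : ℝ) :
    HasSum (fun q : ℤ × ℤ => pairCoeff z r q * exp (((q.1 - q.2 : ℤ) : ℂ) * ω * I))
      (-(‖z‖ ^ 2 * (Real.sinh r ^ 2 + Real.sin ω ^ 2) : ℝ) *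
        exp (I * (2 * (z * trh r ω).re : ℝ))) := by
  have h1 := hasSum_int_mul_besselJLog (log z) (r + ω * I)
  have h2 := hasSum_int_mul_besselJLog ((starRingEnd ℂ) (log z)) (r - ω * I)
  have h := hasSum_mul_complex h1 h2
  have hw : exp (log z) = z := Complex.exp_log hz
  have hwc : exp ((starRingEnd ℂ) (log z)) = (starRingEnd ℂ) z := by rw [Complex.exp_conj, hw]
  refine hasSum_of_eq h (fun q => ?_) ?_
  · have e : exp (q.1 * ((r : ℂ) + ω * I)) * exp (q.2 * ((r : ℂ) - ω * I)) =
        exp (r * (q.1 + q.2)) * exp (((q.1 - q.2 : ℤ) : ℂ) * ω * I) := by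
      rw [← Complex.exp_add, ← Complex.exp_add]
      congr 1; push_cast; ring
    rw [pairCoeff]
    linear_combination (-(q.1 * I ^ q.1 * besselJLog q.1 (log z)) *
      (q.2 * I ^ q.2 * besselJLog q.2 ((starRingEnd ℂ) (log z)))) * e
  · rw [hw, hwc, re_mul_trh, mul_add I, Complex.exp_add]
    have e1 := sinh_mul_sinh r ω
    have e2 : z * (starRingEnd ℂ) z = ((‖z‖ ^ 2 : ℝ) : ℂ) := by
      rw [Complex.mul_conj, Complex.sq_norm]
    rw [ofReal_mul, ← e1, ← e2]
    linear_combination (-(z * (starRingEnd ℂ) z * (sinh (r + ω * I) * sinh (r - ω * I)) *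
      (exp (I * (z * cosh (r + ω * I))) *
        exp (I * ((starRingEnd ℂ) z * cosh (r - ω * I)))))) * Complex.I_sq

theorem integral_exp_int_mul (k : ℤ) :
    ∫ ω : ℝ in (0 : ℝ)..(2 * Real.pi), exp (k * ω * I) = if k = 0 then 2 * (Real.pi : ℂ) else 0 := by
  split_ifs with h
  · simp [h]
  · have hk : (k : ℂ) * I ≠ 0 := mul_ne_zero (Int.cast_ne_zero.2 h) I_ne_zero
    have := integral_exp_mul_complex (a := 0) (b := 2 * Real.pi) hk
    have e : ∀ ω : ℝ, (k : ℂ) * I * ω = k * ω * I := fun ω => by ring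
    simp only [e] at this
    rw [this]
    have h1 : exp ((k : ℂ) * ((2 * Real.pi : ℝ) : ℂ) * I) = 1 := by
      rw [Complex.exp_eq_one_iff]
      exact ⟨k, by push_cast; ring⟩
    rw [h1]
    simp

/-- The oscillating kernel `cos(2 Re(z trh(r, ω))) (sinh² r + sin² ω)`. -/
def kern (z : ℂ) (r ω : ℝ) : ℝ :=
  Real.cos (2 * (z * trh r ω).re) * (Real.sinh r ^ 2 + Real.sin ω ^ 2)

theorem continuous_trh : Continuous fun q : ℝ × ℝ => trh q.1 q.2 := by
  unfold trh; fun_prop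

theorem continuous_kern (z : ℂ) : Continuous fun q : ℝ × ℝ => kern z q.1 q.2 := by
  have := continuous_trh
  unfold kern
  fun_prop

theorem trh_add_pi (r ω : ℝ) : trh r (ω + Real.pi) = -trh r ω := by
  simp only [trh, Real.cos_add_pi, Real.sin_add_pi]
  push_cast
  ring

theorem integral_two_pi_eq (z : ℂ) (r : ℝ) (p : ℤ) :
    ∫ ω : ℝ in (0 : ℝ)..(2 * Real.pi), ((Real.sinh r ^ 2 + Real.sin ω ^ 2 : ℝ) : ℂ) *
      exp (I * (2 * (z * trh r ω).re : ℝ)) * exp (((-2 * p : ℤ) : ℂ) * ω * I) =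
    2 * ∫ ω : ℝ in (0 : ℝ)..Real.pi, (kern z r ω : ℂ) * exp (((-2 * p : ℤ) : ℂ) * ω * I) := by
  set F : ℝ → ℂ := fun ω => ((Real.sinh r ^ 2 + Real.sin ω ^ 2 : ℝ) : ℂ) *
      exp (I * (2 * (z * trh r ω).re : ℝ)) * exp (((-2 * p : ℤ) : ℂ) * ω * I) with hF
  have htrh : Continuous fun ω : ℝ => trh r ω := by unfold trh; fun_prop
  have hc : Continuous F := by
    rw [hF]
    fun_prop
  have hc2 : Continuous fun ω : ℝ => F (ω + Real.pi) := by fun_prop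
  have h1 : ∫ ω : ℝ in Real.pi..(2 * Real.pi), F ω = ∫ ω : ℝ in (0 : ℝ)..Real.pi, F (ω + Real.pi) := by
    rw [intervalIntegral.integral_comp_add_right]
    congr 1 <;> ring
  rw [← intervalIntegral.integral_add_adjacent_intervals (b := Real.pi)
    (hc.intervalIntegrable _ _) (hc.intervalIntegrable _ _), h1,
    ← intervalIntegral.integral_add (hc.intervalIntegrable _ _)
      (hc2.intervalIntegrable _ _),
    ← intervalIntegral.integral_const_mul]
  -- Translation by π negates `trh` and fixes the other factors, so two opposite exponentials
  -- combine into twice a cosine.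
  refine intervalIntegral.integral_congr fun ω _ => ?_
  have e1 : exp (((-2 * p : ℤ) : ℂ) * ((ω + Real.pi : ℝ) : ℂ) * I) =
      exp (((-2 * p : ℤ) : ℂ) * ω * I) := by
    rw [Complex.exp_eq_exp_iff_exists_int]
    exact ⟨-p, by push_cast; ring⟩
  have e2 : exp (I * (2 * (z * trh r ω).re : ℝ)) + exp (I * (-(2 * (z * trh r ω).re) : ℝ)) =
      2 * (Real.cos (2 * (z * trh r ω).re) : ℂ) := by
    rw [ofReal_cos, Complex.two_cos, ofReal_neg]
    ring_nf
  have e3 : (kern z r ω : ℂ) = (Real.cos (2 * (z * trh r ω).re) : ℂ) *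
      ((Real.sinh r ^ 2 + Real.sin ω ^ 2 : ℝ) : ℂ) := by rw [kern, ofReal_mul]
  simp only [hF]
  rw [e1, trh_add_pi, Real.sin_add_pi, neg_sq, mul_neg, neg_re, mul_neg, e3]
  linear_combination (((Real.sinh r ^ 2 + Real.sin ω ^ 2 : ℝ) : ℂ) *
    exp (((-2 * p : ℤ) : ℂ) * ω * I)) * e2

/-- The Fourier coefficients of the kernel are given by Bessel functions at the integers. -/
theorem hasSum_besselPsi {z : ℂ} (hz : z ≠ 0) (p : ℤ) (r : ℝ) :
    HasSum (fun n : ℤ => (-1) ^ n * (besselPsi z p n * exp (2 * r * n)))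
      ((‖z‖ ^ 2 / Real.pi : ℝ) *
        ∫ ω : ℝ in (0 : ℝ)..Real.pi, (kern z r ω : ℂ) * exp (((-2 * p : ℤ) : ℂ) * ω * I)) := by
  have hsum : Summable fun q : ℤ × ℤ => ‖pairCoeff z r q‖ := by
    simpa using (hasSum_pairCoeff hz r 0).summable.norm
  have hnorm : ∀ (q : ℤ × ℤ) (ω : ℝ), ‖pairCoeff z r q * exp (((q.1 - q.2 : ℤ) : ℂ) * ω * I) *
      exp (((-2 * p : ℤ) : ℂ) * ω * I)‖ = ‖pairCoeff z r q‖ := by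
    intro q ω
    rw [norm_mul, norm_mul]
    have : ∀ k : ℤ, ‖exp ((k : ℂ) * ω * I)‖ = 1 := fun k => by
      have := Complex.norm_exp_ofReal_mul_I (k * ω)
      push_cast at this
      exact this
    rw [this, this, mul_one, mul_one]
  -- The characters have norm 1, so the summable norms of the coefficients dominate uniformly in ω.
  have hint := intervalIntegral.hasSum_integral_of_dominated_convergence (μ := volume)
    (a := 0) (b := 2 * Real.pi)
    (F := fun (q : ℤ × ℤ) (ω : ℝ) => pairCoeff z r q * exp (((q.1 - q.2 : ℤ) : ℂ) * ω * I) *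
      exp (((-2 * p : ℤ) : ℂ) * ω * I))
    (f := fun ω : ℝ => -(‖z‖ ^ 2 * (Real.sinh r ^ 2 + Real.sin ω ^ 2) : ℝ) *
        exp (I * (2 * (z * trh r ω).re : ℝ)) * exp (((-2 * p : ℤ) : ℂ) * ω * I))
    (fun q _ => ‖pairCoeff z r q‖)
    (fun q => (by fun_prop : Continuous fun ω : ℝ => pairCoeff z r q *
      exp (((q.1 - q.2 : ℤ) : ℂ) * ω * I) * exp (((-2 * p : ℤ) : ℂ) * ω * I)).aestronglyMeasurable)
    (fun q => ae_of_all _ fun ω _ => (hnorm q ω).le)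
    (ae_of_all _ fun ω _ => hsum) intervalIntegrable_const
    (ae_of_all _ fun ω _ => (hasSum_pairCoeff hz r ω).mul_right _)
  have hval : ∀ q : ℤ × ℤ, ∫ ω : ℝ in (0 : ℝ)..(2 * Real.pi), pairCoeff z r q *
      exp (((q.1 - q.2 : ℤ) : ℂ) * ω * I) * exp (((-2 * p : ℤ) : ℂ) * ω * I) =
      if q.1 - q.2 = 2 * p then 2 * Real.pi * pairCoeff z r q else 0 := by
    intro q
    have : ∀ ω : ℝ, pairCoeff z r q * exp (((q.1 - q.2 : ℤ) : ℂ) * ω * I) *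
        exp (((-2 * p : ℤ) : ℂ) * ω * I) =
        pairCoeff z r q * exp (((q.1 - q.2 - 2 * p : ℤ) : ℂ) * ω * I) := by
      intro ω
      rw [mul_assoc, ← Complex.exp_add]
      congr 2; push_cast; ring
    simp only [this]
    rw [intervalIntegral.integral_const_mul, integral_exp_int_mul]
    simp only [sub_eq_zero]
    split_ifs <;> ring
  simp only [hval] at hint
  -- Orthogonality leaves the pairs with difference 2p, that is (n + p, n - p). There the product of
  -- the orders is n² - p² and the powers of `I` give (-1)^n.
  have hinj : Function.Injective fun n : ℤ => ((n + p, n - p) : ℤ × ℤ) := by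
    intro a b h
    simp only [Prod.mk.injEq] at h
    omega
  rw [← hinj.hasSum_iff] at hint
  swap
  · rintro ⟨m, l⟩ hq
    refine if_neg fun h => hq ⟨m - p, ?_⟩
    simp only [Prod.mk.injEq]
    simp only at h
    omega
  have hI : ∫ ω : ℝ in (0 : ℝ)..(2 * Real.pi),
      -((‖z‖ ^ 2 * (Real.sinh r ^ 2 + Real.sin ω ^ 2) : ℝ) : ℂ) *
        exp (I * (2 * (z * trh r ω).re : ℝ)) * exp (((-2 * p : ℤ) : ℂ) * ω * I) =
      -(‖z‖ ^ 2 : ℝ) * (2 * ∫ ω : ℝ in (0 : ℝ)..Real.pi,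
        (kern z r ω : ℂ) * exp (((-2 * p : ℤ) : ℂ) * ω * I)) := by
    rw [← integral_two_pi_eq, ← intervalIntegral.integral_const_mul]
    refine intervalIntegral.integral_congr fun ω _ => ?_
    simp only [ofReal_mul]
    ring
  rw [hI] at hint
  have hpi : (Real.pi : ℂ) ≠ 0 := ofReal_ne_zero.2 Real.pi_ne_zero
  refine hasSum_of_eq (hint.mul_left (-(1 / (2 * Real.pi)) : ℂ)) (fun n => ?_) ?_
  · have hz1 : (I : ℂ) ^ (n + p) * I ^ (n - p) = (-1) ^ n := by
      rw [← zpow_add₀ I_ne_zero, show n + p + (n - p) = 2 * n by ring, zpow_mul,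
        show (I : ℂ) ^ (2 : ℤ) = -1 from (zpow_natCast I 2).trans Complex.I_sq]
    have he : exp (r * (((n + p : ℤ) : ℂ) + ((n - p : ℤ) : ℂ))) = exp (2 * r * n) := by
      congr 1; push_cast; ring
    simp only [Function.comp_apply]
    rw [if_pos (by ring), pairCoeff]
    simp only
    rw [he, besselPsi, besselJProd, ← hz1]
    push_cast
    field_simp
    ring
  · generalize (∫ ω : ℝ in (0 : ℝ)..Real.pi, (kern z r ω : ℂ) *
      exp (((-2 * p : ℤ) : ℂ) * ω * I)) = T
    push_cast
    field_simp

/-- The `p`-th Fourier coefficient of the kernel in `ω`, up to the factor `π`. -/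
def kernCoeff (z : ℂ) (p : ℤ) (r : ℝ) : ℂ :=
  ∫ ω : ℝ in (0 : ℝ)..Real.pi, (kern z r ω : ℂ) * exp (((-2 * p : ℤ) : ℂ) * ω * I)

/-! ### The Bessel integral for fixed `p`. -/

theorem sin_pi_I_mul_ne_zero {y : ℝ} (hy : y ≠ 0) : sin (Real.pi * (I * y)) ≠ 0 :=
  sin_pi_mul_ne_zero_of_abs_re_lt_one (by simp) (by simp [hy])

theorem besselBold_of_ne_zero {y : ℝ} (hy : y ≠ 0) (p : ℤ) (z : ℂ) :
    besselBold (I * y) p z = besselQuot (I * y) p z :=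
  if_neg (sin_pi_I_mul_ne_zero hy)

theorem integral_kFun_mul_kernCoeff {K : ℝ} (hK : 0 < K) {z : ℂ} (hz : z ≠ 0) (p : ℤ) :
    4 * (‖z‖ ^ 2 : ℝ) * ∫ r : ℝ, (kFun K r : ℂ) * kernCoeff z p r =
      2 * (Real.pi : ℂ) ^ 2 *
        cscIntegral (fun s => (besselPsi z (-p) (-s) - besselPsi z p s) * gauss K s) 0 := by
  have h := (integral_kFun_mul_two_sided (mellinClass_besselPsi z p) (mellinClass_besselPsi z (-p))
    (fun n => by simpa using besselPsi_neg_int z p n) hK (hasSum_besselPsi hz p)).2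
  have e : ∀ r : ℝ, (kFun K r : ℂ) * ((‖z‖ ^ 2 / Real.pi : ℝ) * ∫ ω : ℝ in (0 : ℝ)..Real.pi,
      (kern z r ω : ℂ) * exp (((-2 * p : ℤ) : ℂ) * ω * I)) =
      (‖z‖ ^ 2 / Real.pi : ℝ) * ((kFun K r : ℂ) * kernCoeff z p r) := fun r => by
    rw [kernCoeff]; ring
  simp only [e] at h
  rw [integral_const_mul] at h
  have hpi : (Real.pi : ℂ) ≠ 0 := ofReal_ne_zero.2 Real.pi_ne_zero
  generalize (∫ r : ℝ, (kFun K r : ℂ) * kernCoeff z p r) = T at h ⊢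
  push_cast at h ⊢
  field_simp at h
  linear_combination (2 : ℂ) * h

theorem weight_eq (K P y : ℝ) (p : ℤ) :
    weight K P (y, p) = Real.exp (-((p : ℝ) / P) ^ 2) * Real.exp (-(y / K) ^ 2) := by
  rw [weight, ← Real.exp_add]
  ring_nf

theorem integral_besselIntegrand {K P : ℝ} (hK : 0 < K) {z : ℂ} (hz : z ≠ 0) (p : ℤ) :
    ∫ y : ℝ, besselIntegrand (weight K P) z (y, p) =
      (Real.exp (-((p : ℝ) / P) ^ 2) : ℂ) *
        (4 * (‖z‖ ^ 2 : ℝ) * ∫ r : ℝ, (kFun K r : ℂ) * kernCoeff z p r) := by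
  rw [integral_kFun_mul_kernCoeff hK hz, cscIntegral, ← integral_const_mul, ← integral_const_mul]
  refine integral_congr_ae ?_
  -- The limit value of `besselBold` at κ = 0 plays no role in the integral.
  have : ∀ᵐ y : ℝ, y ≠ 0 := by simp [ae_iff]
  filter_upwards [this] with y hy
  have e1 : ((0 : ℝ) : ℂ) + y * I = I * y := by push_cast; ring
  have e2 : (((-p : ℤ) : ℂ)) ^ 2 - (-(I * (y : ℂ))) ^ 2 = (y : ℂ) ^ 2 + p ^ 2 := by
    rw [neg_sq, mul_pow, I_sq]; push_cast; ring
  have e3 : (p : ℂ) ^ 2 - (I * (y : ℂ)) ^ 2 = (y : ℂ) ^ 2 + p ^ 2 := by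
    rw [mul_pow, I_sq]; ring
  have e4 : gauss K (I * y) = (Real.exp (-(y / K) ^ 2) : ℂ) := by
    rw [gauss, mul_pow, I_sq]
    push_cast
    congr 1
    rw [div_pow]; ring
  rw [e1, besselIntegrand, weight_eq]
  simp only
  rw [besselBold_of_ne_zero hy, besselQuot, besselPsi, besselPsi, e2, e3, e4]
  push_cast
  ring

/-! ### Absolute convergence over ℝ × ℤ. -/

/-- The numerator vanishes at s = 0 because J_{0,-p} = J_{0,p}. For |y| < 1 the Schwarz lemma on the
unit disc makes it O(|y|), while |sin(πiy)| ≥ |y|; for |y| ≥ 1 the sine has norm at least 1. -/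
theorem norm_besselBold_le (z : ℂ) : ∃ C : ℝ, 0 ≤ C ∧ ∀ (y : ℝ) (p : ℤ), y ≠ 0 →
    ‖besselBold (I * y) p z‖ ≤ C * ((p.natAbs + 2).factorial : ℝ) ^ 2 *
      Real.exp (2 * Real.pi * |y|) := by
  set c := Real.exp ((1 : ℕ) * |logSq (log z)|) * Real.exp (2 * Real.exp (logSq (log z))) * 16
  have hpi := Real.pi_pos
  refine ⟨2 * Real.pi ^ 2 * (2 * c * Real.exp (2 * Real.pi)), by positivity, fun y p hy => ?_⟩
  set F : ℝ := ((p.natAbs + 2).factorial : ℝ) ^ 2 with hF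
  set D : ℂ → ℂ := fun s => besselJProd (-s) (-p) z - besselJProd s p z with hD
  have hDb : ∀ s : ℂ, |s.re| ≤ 1 → ‖D s‖ ≤ 2 * c * F * Real.exp (2 * Real.pi * |s.im|) := by
    intro s hs
    have h1 := norm_besselJProd_le z (-s) (-p) (R := 1) (by simpa using hs)
    have h2 := norm_besselJProd_le z s p (R := 1) (by simpa using hs)
    simp only [neg_im, abs_neg, Int.natAbs_neg] at h1
    refine (norm_sub_le _ _).trans ((add_le_add h1 h2).trans (le_of_eq ?_))
    rw [hF]
    ring
  have hDd : Differentiable ℂ D := by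
    have h1 := differentiable_besselJProd p z
    have h2 := differentiable_besselJProd (-p) z
    exact (h2.comp differentiable_neg).sub h1
  have hD0 : D 0 = 0 := by
    have := besselJProd_neg_int 0 (-p) z
    simp only [hD]
    simp at this ⊢
    rw [this, sub_self]
  have hF0 : 0 ≤ F := by positivity
  have hexp : 1 ≤ Real.exp (2 * Real.pi) := Real.one_le_exp (by positivity)
  have hexpy : 1 ≤ Real.exp (2 * Real.pi * |y|) := Real.one_le_exp (by positivity)
  have hIre : (I * (y : ℂ)).re = 0 := by simp
  have hIim : (I * (y : ℂ)).im = y := by simp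
  have hsin : 0 < ‖sin (Real.pi * (I * y))‖ := norm_pos_iff.2 (sin_pi_I_mul_ne_zero hy)
  have key : ‖D (I * y)‖ ≤ 2 * c * F * Real.exp (2 * Real.pi) * Real.exp (2 * Real.pi * |y|) *
      ‖sin (Real.pi * (I * y))‖ := by
    rcases lt_or_ge |y| 1 with h | h
    · have hmaps : MapsTo D (Metric.ball 0 1)
          (Metric.closedBall (D 0) (2 * c * F * Real.exp (2 * Real.pi))) := by
        intro s hs
        rw [Metric.mem_ball, dist_zero_right] at hs
        rw [hD0, Metric.mem_closedBall, dist_zero_right]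
        refine (hDb s ((Complex.abs_re_le_norm s).trans hs.le)).trans ?_
        refine mul_le_mul_of_nonneg_left (Real.exp_le_exp.2 ?_) (by positivity)
        have := (Complex.abs_im_le_norm s).trans hs.le
        nlinarith
      have h1 := Complex.dist_le_div_mul_dist_of_mapsTo_ball hDd.differentiableOn hmaps
        (z := I * y) (by simpa using h)
      rw [hD0, dist_zero_right, dist_zero_right, div_one] at h1
      have h2 : ‖I * (y : ℂ)‖ ≤ ‖sin (Real.pi * (I * y))‖ := by
        refine le_trans ?_ (abs_sinh_im_le_norm_sin _)
        have him : ((Real.pi : ℂ) * (I * y)).im = Real.pi * y := by simp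
        rw [him, norm_mul, norm_I, one_mul, norm_real, Real.norm_eq_abs, Real.abs_sinh]
        refine le_trans ?_ (Real.self_le_sinh_iff.2 (abs_nonneg _))
        rw [abs_mul, abs_of_pos hpi]
        nlinarith [abs_nonneg y, Real.pi_gt_three]
      refine h1.trans (mul_le_mul ?_ h2 (norm_nonneg _) (by positivity))
      exact le_mul_of_one_le_right (by positivity) hexpy
    · have h1 := hDb (I * y) (by rw [hIre]; simp)
      rw [hIim] at h1
      have h2 := one_add_sq_le_norm_sin (s := I * y) (by rw [hIim]; exact h)
      rw [hIim] at h2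
      have h3 : 1 ≤ ‖sin (Real.pi * (I * y))‖ := by nlinarith [sq_nonneg y]
      refine h1.trans ?_
      calc _ ≤ 2 * c * F * Real.exp (2 * Real.pi * |y|) * (Real.exp (2 * Real.pi) *
            ‖sin (Real.pi * (I * y))‖) :=
            le_mul_of_one_le_right (by positivity) (one_le_mul_of_one_le_of_one_le hexp h3)
        _ = _ := by ring
  rw [besselBold_of_ne_zero hy, besselQuot, norm_mul, norm_div, div_mul_eq_mul_div,
    div_le_iff₀ hsin]
  have hn : ‖2 * (Real.pi : ℂ) ^ 2‖ = 2 * Real.pi ^ 2 := by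
    rw [norm_mul, norm_pow, norm_real, Real.norm_of_nonneg hpi.le]; simp
  rw [hn]
  refine (mul_le_mul_of_nonneg_left key (by positivity)).trans (le_of_eq ?_)
  ring

/-- A Gaussian beats any power of a factorial, by the ratio test. The cube combines two factorials
from the Bessel bound and one that dominates 1 + p². -/
theorem summable_factorial_pow_mul_gauss {P : ℝ} (hP : 0 < P) :
    Summable fun p : ℤ => ((p.natAbs + 2).factorial : ℝ) ^ 3 * Real.exp (-((p : ℝ) / P) ^ 2) := by
  have hnat : Summable fun n : ℕ =>
      ((n + 2).factorial : ℝ) ^ 3 * Real.exp (-((n : ℝ) / P) ^ 2) := by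
    refine summable_of_ratio_norm_eventually_le (r := 1 / 2) (by norm_num) ?_
    set ρ := Real.exp (-(2 / P ^ 2)) with hρ
    have hρ0 : 0 < ρ := Real.exp_pos _
    have hρ1 : |ρ| < 1 := by
      rw [abs_of_pos hρ0, hρ, Real.exp_lt_one_iff, neg_lt_zero]
      positivity
    -- The shift by 3 matches (n + 3)! / (n + 2)! = n + 3; the surplus ρ³ is divided out below.
    have hlim := (tendsto_pow_const_mul_const_pow_of_abs_lt_one 3 hρ1).comp
      (tendsto_add_atTop_nat 3)
    have hev := hlim.eventually (ge_mem_nhds (by positivity : (0 : ℝ) < ρ ^ 3 / 2))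
    filter_upwards [hev] with n hn
    simp only [Function.comp_apply, pow_add] at hn
    have hn2 : ((n + 3 : ℕ) : ℝ) ^ 3 * ρ ^ n ≤ 1 / 2 := by
      have : 0 < ρ ^ 3 := by positivity
      have h2 : (((n + 3 : ℕ) : ℝ) ^ 3 * ρ ^ n) * ρ ^ 3 ≤ 1 / 2 * ρ ^ 3 := by linarith
      exact le_of_mul_le_mul_right h2 this
    have hexp : Real.exp (-(((n + 1 : ℕ) : ℝ) / P) ^ 2) ≤
        ρ ^ n * Real.exp (-((n : ℝ) / P) ^ 2) := by
      rw [hρ, ← Real.exp_nat_mul, ← Real.exp_add]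
      refine Real.exp_le_exp.2 ?_
      have : ((n : ℝ) * -(2 / P ^ 2) + -((n : ℝ) / P) ^ 2) - -(((n + 1 : ℕ) : ℝ) / P) ^ 2 =
          1 / P ^ 2 := by
        push_cast; field_simp; ring
      have h0 : 0 ≤ 1 / P ^ 2 := by positivity
      linarith
    rw [Real.norm_of_nonneg (by positivity), Real.norm_of_nonneg (by positivity)]
    have hfac : ((n + 1 + 2).factorial : ℝ) = ((n + 3 : ℕ) : ℝ) * (n + 2).factorial := by
      rw [show n + 1 + 2 = (n + 2) + 1 by ring, Nat.factorial_succ]; push_cast; ring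
    rw [hfac, mul_pow]
    calc _ ≤ ((n + 3 : ℕ) : ℝ) ^ 3 * ((n + 2).factorial : ℝ) ^ 3 *
          (ρ ^ n * Real.exp (-((n : ℝ) / P) ^ 2)) :=
          mul_le_mul_of_nonneg_left hexp (by positivity)
      _ = (((n + 3 : ℕ) : ℝ) ^ 3 * ρ ^ n) * (((n + 2).factorial : ℝ) ^ 3 *
          Real.exp (-((n : ℝ) / P) ^ 2)) := by ring
      _ ≤ _ := mul_le_mul_of_nonneg_right hn2 (by positivity)
  refine Summable.of_nat_of_neg ?_ ?_
  · simpa using hnat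
  · simpa [neg_div] using hnat

theorem one_add_sq_le_factorial (n : ℕ) : 1 + (n : ℝ) ^ 2 ≤ ((n + 2).factorial : ℝ) := by
  have h : (n + 2) * (n + 1) * 1 ≤ (n + 2).factorial := by
    rw [Nat.factorial_succ, Nat.factorial_succ, mul_assoc]
    gcongr
    exact Nat.factorial_pos n
  have h' : ((n : ℝ) + 2) * (n + 1) * 1 ≤ ((n + 2).factorial : ℝ) := by exact_mod_cast h
  nlinarith [(Nat.cast_nonneg n : (0 : ℝ) ≤ n)]

theorem integrable_exp_mul_gauss {K : ℝ} (hK : 0 < K) :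
    Integrable fun y : ℝ => Real.exp (-(y / K) ^ 2) * (Real.exp (2 * Real.pi * |y|) * (1 + y ^ 2)) := by
  have h1 := integrable_kFun_mul_exp (inv_pos.2 hK) (Real.pi + 1 / 2)
  have h2 := integrable_kFun_mul_exp (inv_pos.2 hK) (-(Real.pi + 1 / 2))
  refine ((h1.add h2).const_mul (2 * (Real.sqrt Real.pi * K⁻¹)⁻¹)).mono'
    (by fun_prop) (ae_of_all _ fun y => ?_)
  have hpi := Real.pi_pos
  have hc : 0 < Real.sqrt Real.pi * K⁻¹ := by positivity
  have hk : kFun K⁻¹ y = Real.sqrt Real.pi * K⁻¹ * Real.exp (-(y / K) ^ 2) := by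
    rw [kFun]; ring_nf
  have e1 : 1 + y ^ 2 ≤ 2 * Real.exp |y| := by
    have := Real.quadratic_le_exp_of_nonneg (abs_nonneg y)
    rw [sq_abs] at this
    nlinarith [abs_nonneg y]
  have e2 : Real.exp ((2 * Real.pi + 1) * |y|) ≤
      Real.exp (2 * y * (Real.pi + 1 / 2)) + Real.exp (2 * y * (-(Real.pi + 1 / 2))) := by
    rcases abs_cases y with ⟨h, _⟩ | ⟨h, _⟩
    · rw [h, show (2 * Real.pi + 1) * y = 2 * y * (Real.pi + 1 / 2) by ring]
      linarith [Real.exp_pos (2 * y * (-(Real.pi + 1 / 2)))]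
    · rw [h, show (2 * Real.pi + 1) * -y = 2 * y * (-(Real.pi + 1 / 2)) by ring]
      linarith [Real.exp_pos (2 * y * (Real.pi + 1 / 2))]
  rw [Real.norm_of_nonneg (by positivity)]
  simp only [Pi.add_apply, hk]
  calc _ ≤ Real.exp (-(y / K) ^ 2) * (2 * Real.exp ((2 * Real.pi + 1) * |y|)) := by
        refine mul_le_mul_of_nonneg_left ?_ (Real.exp_pos _).le
        rw [add_mul, Real.exp_add, one_mul]
        nlinarith [Real.exp_pos (2 * Real.pi * |y|)]
    _ ≤ Real.exp (-(y / K) ^ 2) * (2 * (Real.exp (2 * y * (Real.pi + 1 / 2)) +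
        Real.exp (2 * y * (-(Real.pi + 1 / 2))))) := by gcongr
    _ = _ := by field_simp

theorem measurable_besselIntegrand (K P : ℝ) (z : ℂ) :
    Measurable (besselIntegrand (weight K P) z) := by
  refine measurable_from_prod_countable_left fun p => ?_
  have hq : Measurable fun y : ℝ => besselQuot (I * y) p z := by
    have h1 := (differentiable_besselJProd p z).continuous
    have h2 := (differentiable_besselJProd (-p) z).continuous
    have h3 : Continuous fun y : ℝ => besselJProd (-(I * y)) (-p) z - besselJProd (I * y) p z :=
      (h2.comp (by fun_prop : Continuous fun y : ℝ => -(I * (y : ℂ)))).sub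
        (h1.comp (by fun_prop : Continuous fun y : ℝ => I * (y : ℂ)))
    have h4 : Continuous fun y : ℝ => sin (Real.pi * (I * y)) := by fun_prop
    exact (measurable_const.div h4.measurable).mul h3.measurable
  have hb : Measurable fun y : ℝ => besselBold (I * y) p z := by
    have : (fun y : ℝ => besselBold (I * y) p z) = fun y : ℝ =>
        if y = 0 then besselBold (I * (0 : ℝ)) p z else besselQuot (I * y) p z := by
      funext y
      split_ifs with h
      · rw [h]
      · exact besselBold_of_ne_zero h p z
    rw [this]
    exact Measurable.ite (measurableSet_singleton 0) measurable_const hq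
  have hw : Continuous fun y : ℝ => (weight K P (y, p) : ℂ) := by
    unfold weight; fun_prop
  have hp : Continuous fun y : ℝ => ((y : ℂ) ^ 2 + (p : ℂ) ^ 2) := by fun_prop
  exact (hw.measurable.mul hb).mul hp.measurable

theorem integrable_besselIntegrand {K P : ℝ} (hK : 0 < K) (hP : 0 < P) (z : ℂ) :
    Integrable (besselIntegrand (weight K P) z) muA := by
  obtain ⟨C, hC0, hC⟩ := norm_besselBold_le z
  have hcount : Integrable (fun p : ℤ => C * (((p.natAbs + 2).factorial : ℝ) ^ 3 *
      Real.exp (-((p : ℝ) / P) ^ 2))) Measure.count :=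
    integrable_count_iff.2 ((summable_factorial_pow_mul_gauss hP).mul_left C).norm
  refine ((integrable_exp_mul_gauss hK).mul_prod hcount).mono'
    (measurable_besselIntegrand K P z).aestronglyMeasurable ?_
  have hae : ∀ᵐ y : ℝ, y ≠ 0 := by simp [ae_iff]
  have hae2 : ∀ᵐ a : ℝ × ℤ ∂((volume : Measure ℝ).prod Measure.count), a.1 ≠ 0 :=
    Measure.quasiMeasurePreserving_fst.ae hae
  refine hae2.mono ?_
  rintro ⟨y, p⟩ hy
  have h1 := hC y p hy
  have h2 : ‖(y : ℂ) ^ 2 + (p : ℂ) ^ 2‖ ≤ (1 + y ^ 2) * (p.natAbs + 2).factorial := by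
    have h3 := one_add_sq_le_factorial p.natAbs
    have h4 : ((p.natAbs : ℝ)) ^ 2 = (p : ℝ) ^ 2 := by
      rw [Nat.cast_natAbs, Int.cast_abs, sq_abs]
    rw [h4] at h3
    have h5 : ‖(y : ℂ) ^ 2 + (p : ℂ) ^ 2‖ = y ^ 2 + (p : ℝ) ^ 2 := by
      have : ((y : ℂ) ^ 2 + (p : ℂ) ^ 2) = ((y ^ 2 + (p : ℝ) ^ 2 : ℝ) : ℂ) := by push_cast; ring
      rw [this, norm_real, Real.norm_of_nonneg (by positivity)]
    rw [h5]
    refine le_trans ?_ (mul_le_mul_of_nonneg_left h3 (by positivity))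
    nlinarith [mul_nonneg (sq_nonneg y) (sq_nonneg (p : ℝ))]
  rw [besselIntegrand, norm_mul, norm_mul, norm_real, weight_eq,
    Real.norm_of_nonneg (by positivity)]
  simp only
  calc _ ≤ Real.exp (-((p : ℝ) / P) ^ 2) * Real.exp (-(y / K) ^ 2) *
      (C * ((p.natAbs + 2).factorial : ℝ) ^ 2 * Real.exp (2 * Real.pi * |y|)) *
      ((1 + y ^ 2) * (p.natAbs + 2).factorial) := by gcongr
    _ = _ := by ring

theorem besselH_eq_tsum {K P : ℝ} (hK : 0 < K) (hP : 0 < P) {z : ℂ} (hz : z ≠ 0) :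
    besselH (weight K P) z = ∑' p : ℤ, (Real.exp (-((p : ℝ) / P) ^ 2) : ℂ) *
        (4 * (‖z‖ ^ 2 : ℝ) * ∫ r : ℝ, (kFun K r : ℂ) * kernCoeff z p r) := by
  have hint := integrable_besselIntegrand hK hP z
  rw [besselH, muA, integral_prod_symm _ hint]
  have h2 := Integrable.integral_prod_right hint
  rw [integral_countable h2]
  refine tsum_congr fun p => ?_
  rw [integral_besselIntegrand hK hz]
  simp [Measure.real]

/-! ### Poisson summation and the integral over ℝ × ℝ/πℤ. -/

theorem summable_exp_neg_div_sq {P : ℝ} (hP : 0 < P) :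
    Summable fun p : ℤ => Real.exp (-((p : ℝ) / P) ^ 2) := by
  refine (summable_factorial_pow_mul_gauss hP).of_nonneg_of_le (fun p => (Real.exp_pos _).le)
    fun p => le_mul_of_one_le_left (Real.exp_pos _).le ?_
  exact one_le_pow₀ (by exact_mod_cast Nat.factorial_pos _)

/-- Poisson summation for the theta function. -/
theorem thetaFun_eq_tsum {P : ℝ} (hP : 0 < P) (ω : ℝ) :
    (thetaFun P ω : ℂ) =
      ∑' p : ℤ, (Real.exp (-((p : ℝ) / P) ^ 2) : ℂ) * exp (((-2 * p : ℤ) : ℂ) * ω * I) := by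
  have hpi := Real.pi_pos
  have hpic : (Real.pi : ℂ) ≠ 0 := ofReal_ne_zero.2 hpi.ne'
  have hPc : (P : ℂ) ≠ 0 := ofReal_ne_zero.2 hP.ne'
  have ha : 0 < (((1 / (Real.pi * P ^ 2) : ℝ)) : ℂ).re := by
    rw [ofReal_re]; positivity
  -- With a = 1/(πP²) and b = -iω/π, the quadratic and linear exponents become -(p/P)² and -2ipω,
  -- and the dual exponent is -(P(ω + πq))².
  have h := Complex.tsum_exp_neg_quadratic ha (-I * ω / Real.pi)
  have h1 : (1 : ℂ) / ((1 / (Real.pi * P ^ 2) : ℝ) : ℂ) ^ (1 / 2 : ℂ) =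
      (Real.sqrt Real.pi * P : ℝ) := by
    rw [show (1 / 2 : ℂ) = ((1 / 2 : ℝ) : ℂ) by norm_num, ← ofReal_cpow (by positivity),
      ← Real.sqrt_eq_rpow, ← ofReal_one, ← ofReal_div, Real.sqrt_div zero_le_one, Real.sqrt_one,
      one_div_one_div, Real.sqrt_mul hpi.le, Real.sqrt_sq hP.le]
  rw [h1] at h
  rw [thetaFun, ofReal_mul, ofReal_tsum]
  refine Eq.trans ?_ (h.symm.trans ?_)
  · congr 1
    refine tsum_congr fun q => ?_
    rw [ofReal_exp]
    congr 1
    push_cast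
    field_simp
    rw [I_sq]
    ring
  · refine tsum_congr fun p => ?_
    rw [ofReal_exp, ← Complex.exp_add]
    congr 1
    push_cast
    field_simp

/-- The kernel as a function on `ℝ × ℝ/πℤ`. -/
def kernCircle (z : ℂ) (x : ℝ × AddCircle Real.pi) : ℝ :=
  cosTrh z x.1 x.2 * (Real.sinh x.1 ^ 2 + sinSq x.2)

theorem kernCircle_coe (z : ℂ) (r ω : ℝ) : kernCircle z (r, (ω : AddCircle Real.pi)) = kern z r ω :=
  rfl

theorem continuous_kernCircle (z : ℂ) : Continuous (kernCircle z) := by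
  have hq : IsOpenQuotientMap (Prod.map id (fun ω : ℝ => (ω : AddCircle Real.pi)) :
      ℝ × ℝ → ℝ × AddCircle Real.pi) :=
    IsOpenQuotientMap.id.prodMap QuotientAddGroup.isOpenQuotientMap_mk
  rw [hq.isQuotientMap.continuous_iff]
  exact continuous_kern z

theorem norm_kernCircle_le (z : ℂ) (x : ℝ × AddCircle Real.pi) :
    ‖kernCircle z x‖ ≤ Real.cosh x.1 ^ 2 := by
  obtain ⟨r, ω⟩ := x
  induction ω using QuotientAddGroup.induction_on with
  | H ω =>
    change ‖kern z r ω‖ ≤ Real.cosh r ^ 2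
    rw [kern, norm_mul, Real.norm_eq_abs, Real.norm_of_nonneg (by positivity)]
    have h1 := Real.abs_cos_le_one (2 * (z * trh r ω).re)
    have h2 := Real.sin_sq_le_one ω
    have h3 := Real.cosh_sq r
    nlinarith [sq_nonneg (Real.sinh r), sq_nonneg (Real.sin ω)]

/-- The character `ω ↦ exp(-2ipω)` of `ℝ/πℤ`. -/
def circleChar (p : ℤ) : C(AddCircle Real.pi, ℂ) := fourier (-p)

theorem circleChar_coe (p : ℤ) (ω : ℝ) :
    circleChar p (ω : AddCircle Real.pi) = exp (((-2 * p : ℤ) : ℂ) * ω * I) := by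
  have hpic : (Real.pi : ℂ) ≠ 0 := ofReal_ne_zero.2 Real.pi_ne_zero
  rw [circleChar, fourier_coe_apply]
  congr 1
  push_cast
  field_simp

theorem norm_circleChar (p : ℤ) (ω : AddCircle Real.pi) : ‖circleChar p ω‖ = 1 := by
  rw [circleChar, fourier_apply]
  exact Circle.norm_coe _

theorem theta_eq_tsum {P : ℝ} (hP : 0 < P) (ω : AddCircle Real.pi) :
    (theta P ω : ℂ) = ∑' p : ℤ, (Real.exp (-((p : ℝ) / P) ^ 2) : ℂ) * circleChar p ω := by
  induction ω using QuotientAddGroup.induction_on with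
  | H ω =>
    refine (thetaFun_eq_tsum hP ω).trans (tsum_congr fun p => ?_)
    rw [← circleChar_coe]

theorem norm_theta_term (P : ℝ) (p : ℤ) (ω : AddCircle Real.pi) :
    ‖(Real.exp (-((p : ℝ) / P) ^ 2) : ℂ) * circleChar p ω‖ = Real.exp (-((p : ℝ) / P) ^ 2) := by
  rw [norm_mul, norm_circleChar, mul_one, norm_real, Real.norm_of_nonneg (Real.exp_pos _).le]

theorem continuous_theta {P : ℝ} (hP : 0 < P) : Continuous (theta P) := by
  have h : Continuous fun ω => (theta P ω : ℂ) := by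
    simp only [theta_eq_tsum hP]
    exact continuous_tsum (fun p => by fun_prop) (summable_exp_neg_div_sq hP)
      fun p ω => (norm_theta_term P p ω).le
  exact continuous_re.comp h

theorem integrable_cosh_sq_mul_kFun {K : ℝ} (hK : 0 < K) :
    Integrable fun r : ℝ => Real.cosh r ^ 2 * kFun K r := by
  have h1 := integrable_kFun_mul_exp hK 1
  have h2 := integrable_kFun_mul_exp hK (-1)
  have h3 := integrable_kFun_mul_exp hK 0
  refine (((h1.add h2).add (h3.const_mul 2)).const_mul (1 / 4)).congr (ae_of_all _ fun r => ?_)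
  have e1 : Real.exp (2 * r * 1) = Real.exp r ^ 2 := by rw [← Real.exp_nat_mul]; norm_num
  have e2 : Real.exp (2 * r * -1) = Real.exp (-r) ^ 2 := by rw [← Real.exp_nat_mul]; norm_num
  have e3 : Real.exp r * Real.exp (-r) = 1 := by rw [← Real.exp_add]; simp
  simp only [Pi.add_apply, e1, e2, mul_zero, Real.exp_zero, Real.cosh_eq]
  linear_combination (-(1 / 2) * kFun K r) * e3

/-- The `p`-th term of the integrand after expanding the theta function. -/
def rhsTerm (K P : ℝ) (z : ℂ) (p : ℤ) (x : ℝ × AddCircle Real.pi) : ℂ :=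
  (kernCircle z x : ℂ) * kFun K x.1 * ((Real.exp (-((p : ℝ) / P) ^ 2) : ℂ) * circleChar p x.2)

theorem norm_rhsTerm_le {K : ℝ} (hK : 0 < K) (P : ℝ) (z : ℂ) (p : ℤ)
    (x : ℝ × AddCircle Real.pi) : ‖rhsTerm K P z p x‖ ≤
      Real.exp (-((p : ℝ) / P) ^ 2) * (Real.cosh x.1 ^ 2 * kFun K x.1 * 1) := by
  rw [rhsTerm, norm_mul, norm_theta_term, mul_comm, norm_mul, norm_real, norm_real,
    Real.norm_of_nonneg (kFun_nonneg hK _), mul_one]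
  exact mul_le_mul_of_nonneg_left (mul_le_mul_of_nonneg_right (norm_kernCircle_le z x)
    (kFun_nonneg hK _)) (Real.exp_pos _).le

theorem integrable_cosh_sq_mul_kFun_prod {K : ℝ} (hK : 0 < K) :
    Integrable fun x : ℝ × AddCircle Real.pi => Real.cosh x.1 ^ 2 * kFun K x.1 * 1 :=
  (integrable_cosh_sq_mul_kFun hK).mul_prod (integrable_const (1 : ℝ))

theorem integrable_rhsTerm {K : ℝ} (hK : 0 < K) (P : ℝ) (z : ℂ) (p : ℤ) :
    Integrable (rhsTerm K P z p) := by
  refine ((integrable_cosh_sq_mul_kFun_prod hK).const_mul _).mono' ?_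
    (ae_of_all _ (norm_rhsTerm_le hK P z p))
  have h1 := continuous_kernCircle z
  have h2 := continuous_kFun K
  have h3 := (circleChar p).continuous
  exact (by unfold rhsTerm; fun_prop : Continuous (rhsTerm K P z p)).aestronglyMeasurable

theorem integral_rhsTerm {K : ℝ} (hK : 0 < K) (P : ℝ) (z : ℂ) (p : ℤ) :
    ∫ x, rhsTerm K P z p x = (Real.exp (-((p : ℝ) / P) ^ 2) : ℂ) *
      ∫ r : ℝ, (kFun K r : ℂ) * kernCoeff z p r := by
  rw [Measure.volume_eq_prod, integral_prod _ (integrable_rhsTerm hK P z p),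
    ← integral_const_mul]
  refine integral_congr_ae (ae_of_all _ fun r => ?_)
  simp only
  rw [← AddCircle.intervalIntegral_preimage Real.pi 0, zero_add, kernCoeff, ← mul_assoc,
    ← intervalIntegral.integral_const_mul]
  refine intervalIntegral.integral_congr fun ω _ => ?_
  simp only [rhsTerm, kernCircle_coe, circleChar_coe]
  ring

theorem rhs_eq_tsum {K P : ℝ} (hP : 0 < P) (z : ℂ) (x : ℝ × AddCircle Real.pi) :
    ((cosTrh z x.1 x.2 * (Real.sinh x.1 ^ 2 + sinSq x.2) * kFun K x.1 * theta P x.2 : ℝ) : ℂ) =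
      ∑' p : ℤ, rhsTerm K P z p x := by
  rw [ofReal_mul, theta_eq_tsum hP, ← tsum_mul_left]
  refine tsum_congr fun p => ?_
  rw [rhsTerm, kernCircle, ofReal_mul (_ * _) (kFun K x.1)]

/-- Sum and integral may be exchanged because the norm of each term is at most exp(-(p/P)²) times
one integrable function independent of `p`. -/
theorem hasSum_integral_rhsTerm {K P : ℝ} (hK : 0 < K) (hP : 0 < P) (z : ℂ) :
    HasSum (fun p : ℤ => ∫ x, rhsTerm K P z p x) (∫ x, ∑' p : ℤ, rhsTerm K P z p x) := by
  refine hasSum_integral_of_summable_integral_norm (integrable_rhsTerm hK P z) ?_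
  refine ((summable_exp_neg_div_sq hP).mul_right
    (∫ x : ℝ × AddCircle Real.pi, Real.cosh x.1 ^ 2 * kFun K x.1 * 1)).of_nonneg_of_le
    (fun p => integral_nonneg fun x => norm_nonneg _) fun p => ?_
  rw [← integral_const_mul]
  exact integral_mono (integrable_rhsTerm hK P z p).norm
    ((integrable_cosh_sq_mul_kFun_prod hK).const_mul _) (norm_rhsTerm_le hK P z p)

theorem integrable_rhs {K P : ℝ} (hK : 0 < K) (hP : 0 < P) (z : ℂ) :
    Integrable fun x : ℝ × AddCircle Real.pi =>
      cosTrh z x.1 x.2 * (Real.sinh x.1 ^ 2 + sinSq x.2) * kFun K x.1 * theta P x.2 := by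
  obtain ⟨M, hM⟩ := isCompact_univ.exists_bound_of_continuousOn (continuous_theta hP).continuousOn
  refine ((integrable_cosh_sq_mul_kFun_prod hK).mul_const M).mono' ?_ (ae_of_all _ fun x => ?_)
  · have h1 := continuous_kernCircle z
    have h2 := continuous_kFun K
    have h3 := continuous_theta hP
    exact (by fun_prop : Continuous fun x : ℝ × AddCircle Real.pi =>
      kernCircle z x * kFun K x.1 * theta P x.2).aestronglyMeasurable
  · change ‖kernCircle z x * kFun K x.1 * theta P x.2‖ ≤ _
    rw [norm_mul, norm_mul, Real.norm_of_nonneg (kFun_nonneg hK _), mul_one]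
    exact mul_le_mul (mul_le_mul_of_nonneg_right (norm_kernCircle_le z x) (kFun_nonneg hK _))
      (hM x.2 (mem_univ _)) (norm_nonneg _)
      (mul_nonneg (sq_nonneg _) (kFun_nonneg hK _))

end BesselIntegral

end

theorem mainTheorem5 (K P : ℝ) (hK : 0 < K) (hP : 0 < P) (z : ℂ) (hz : z ≠ 0) :
    Integrable (BesselIntegral.besselIntegrand (BesselIntegral.weight K P) z)
        BesselIntegral.muA ∧
      Integrable (fun x : ℝ × AddCircle Real.pi =>
        BesselIntegral.cosTrh z x.1 x.2 * (Real.sinh x.1 ^ 2 + BesselIntegral.sinSq x.2) *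
          BesselIntegral.kFun K x.1 * BesselIntegral.theta P x.2) ∧
      BesselIntegral.besselH (BesselIntegral.weight K P) z =
        ((‖2 * z‖ ^ 2 * ∫ x : ℝ × AddCircle Real.pi,
          BesselIntegral.cosTrh z x.1 x.2 * (Real.sinh x.1 ^ 2 + BesselIntegral.sinSq x.2) *
            BesselIntegral.kFun K x.1 * BesselIntegral.theta P x.2 : ℝ) : ℂ) := by
  refine ⟨BesselIntegral.integrable_besselIntegrand hK hP z,
    BesselIntegral.integrable_rhs hK hP z, ?_⟩
  rw [BesselIntegral.besselH_eq_tsum hK hP hz, Complex.ofReal_mul, ← integral_complex_ofReal]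
  simp only [BesselIntegral.rhs_eq_tsum hP]
  rw [← (BesselIntegral.hasSum_integral_rhsTerm hK hP z).tsum_eq, ← tsum_mul_left]
  refine tsum_congr fun p => ?_
  rw [BesselIntegral.integral_rhsTerm hK, norm_mul]
  push_cast
  rw [Complex.norm_ofNat]
  push_cast
  ring
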